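/- Let $(\Omega,\mathcal K,\mathbb P)$ be a probability space, let $T:\Omega\to\Omega$ be a bijective, bi-measurable transformation which preserves $\mathbb P$ and is ergodic, and let $\mathcal F_0\subseteq\mathcal K$ be a $\sigma$-algebra with $\mathcal F_0\subseteq T^{-1}(\mathcal F_0)$. Let $(\mathbb P^{\omega})_{\omega\in\Omega}$ be a regular conditional probability given $\mathcal F_0$, i.e. each $\mathbb P^\omega$ is a probability measure on $\mathcal K$ and, for each $A\in\mathcal K$, $\omega\mapsto\mathbb P^\omega(A)$ is an $\mathcal F_0$-measurable version of $\mathbb P(A\mid\mathcal F_0)$. Let $t\in(0,2\pi)$ be such that $e^{-2it}$ is not an eigenvalue of $T$, i.e. not an eigenvalue of the operator $f\mapsto f\circ T$ on the complex space $L^2(\Omega,\mathcal K,\mathbb P)$. Let $D:\Omega\to\mathbb C$ be an $\mathcal F_0$-measurable, square-integrable random variable such that $\mathbb E(D\circ T\mid\mathcal F_0)=0$ $\mathbb P$-a.s. For $k\ge 1$ and $n\ge 1$ put $$\mathbf D_k(t)=\bigl(\operatorname{Re}(e^{ikt}D\circ T^k),\ \operatorname{Im}(e^{ikt}D\circ T^k)\bigr),\qquad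 \mathbf M_n(t)=\sum_{k=1}^n\mathbf D_k(t).$$ Then there is a set $\Omega'$ with $\mathbb P(\Omega')=1$ such that, for all $\omega\in\Omega'$, as $n\to\infty$, $$\frac1{\sqrt n}\,\mathbf M_n(t)\Rightarrow (N_1,N_2)\qquad\text{in distribution under }\mathbb P^\omega,$$ where $N_1,N_2$ are independent centered normal random variables, each with variance $\mathbb E|D|^2/2$. -/

import Mathlib

open MeasureTheory ProbabilityTheory Filter

/-- A Markov kernel `κ`, from `Ω` with the σ-algebra `F₀` to `Ω` with the full σ-algebra
`mΩ`, is a regular conditional probability of `P` given `F₀`: for each measurable `A`,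
`κ ω A = P(A | F₀)(ω)` for `P`-a.e. `ω`. -/
def IsRegularCondProb {Ω : Type*} {F₀ mΩ : MeasurableSpace Ω} (P : Measure Ω)
    (κ : @Kernel Ω Ω F₀ mΩ) [∀ ω, IsProbabilityMeasure (κ ω)] : Prop :=
  ∀ A : Set Ω, MeasurableSet[mΩ] A → (fun ω => (κ ω).real A) =ᵐ[P] P⟦A | F₀⟧

/-- `z` is an eigenvalue of the measure-preserving map `T`, that is, of the operator
`f ↦ f ∘ T` on the complex Hilbert space `L²(P)`. -/
def IsKoopmanEigenvalue {Ω : Type*} [MeasurableSpace Ω] {P : Measure Ω} {T : Ω → Ω}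
    (hT : MeasurePreserving T P P) (z : ℂ) : Prop :=
  Module.End.HasEigenvalue
    (Lp.compMeasurePreservingₗ ℂ T hT : Lp ℂ 2 P →ₗ[ℂ] Lp ℂ 2 P) z

/-- `𝐃_k(t) = (Re (e^{ikt} D ∘ T^k), Im (e^{ikt} D ∘ T^k))`. -/
noncomputable def rotatedDiff {Ω : Type*} (T : Ω → Ω) (D : Ω → ℂ) (t : ℝ) (k : ℕ) (x : Ω) :
    ℝ × ℝ :=
  ((Complex.exp (Complex.I * k * t) * D (T^[k] x)).re,
   (Complex.exp (Complex.I * k * t) * D (T^[k] x)).im)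

/-- `𝐌_n(t) = ∑_{k=1}^n 𝐃_k(t)`. -/
noncomputable def rotatedMart {Ω : Type*} (T : Ω → Ω) (D : Ω → ℂ) (t : ℝ) (n : ℕ) (x : Ω) :
    ℝ × ℝ :=
  ∑ k ∈ Finset.Icc 1 n, rotatedDiff T D t k x

/-! By Lévy's criterion it suffices to treat characteristic functions, so fix `w : ℂ` and consider
the real variables X_k = Re(conj(w) e^{ikt} D ∘ T^k). Three facts combine.

For almost every ω the D ∘ T^k, k ≥ 1, are still martingale differences under P^ω. This needs one
null set for all events of the past. The past is therefore taken to be σ(D ∘ T, …, D ∘ T^k), where a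
countable π-system suffices (`IsRegularCondProb.ae_forall_setIntegral_eq_zero`).

The squares average to a constant. From Re(u)² = |u|²/2 + Re(u²)/2, the Cesàro means of X_k² split
in two. The first part tends to |w|² E|D|²/2 by Birkhoff's theorem. The second is a rotated average
of (D ∘ T^k)² with phase e^{2ikt}, and tends to 0 because e^{-2it} is not an eigenvalue. Both limits
come from `ae_tendsto_rotatedAverage`: the maximal inequality reduces it to functions g - A_N g plus
a constant, with A_N the rotated average, and the mean ergodic theorem shows that these approximate.
P-a.e. limits remain P^ω-a.e. limits for almost every ω.

The variables |D ∘ T^k|/√k have a common bound that is integrable under P, hence under almost every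
P^ω (`lintegral_orbitExcess_ne_top`).

McLeish's argument (`tendsto_integral_exp_martingale`) concludes: exp(i∑x) is close to e^{-s/2} ∏(1
+ ix), and a stopped version of the product has expectation exactly 1. The limit exp(-|w|² E|D|²/4)
does not depend on ω and is the characteristic function of (N₁, N₂). -/

/-! ### Exponentials against products, and Cesàro means -/

/-- The exponent is not optimal (r²/2 would do); it is used only to bound a product by the
exponential of a sum of squares. -/
lemma norm_one_add_I_mul_le_exp (r : ℝ) : ‖1 + Complex.I * (r : ℂ)‖ ≤ Real.exp (r ^ 2) := by
  refine le_trans ?_ (Real.add_one_le_exp _)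
  refine abs_le_of_sq_le_sq' ?_ (by positivity) |>.2
  rw [← Complex.normSq_eq_norm_sq, Complex.normSq_apply]
  simp
  nlinarith [sq_nonneg r, sq_nonneg (r ^ 2)]

open Topology in
/-- A triangular array with negligible entries whose sums of squares converge to `s`: the
exponential `exp (i ∑ x)` is asymptotically `exp (-s/2) ∏ (1 + i x)`. -/
lemma tendsto_exp_sum_sub_prod_one_add {x : ℕ → ℕ → ℝ} {s : ℝ}
    (hmax : ∀ ε > 0, ∀ᶠ n in atTop, ∀ k < n, |x n k| ≤ ε)
    (hsq : Tendsto (fun n => ∑ k ∈ Finset.range n, x n k ^ 2) atTop (𝓝 s)) :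
    Tendsto (fun n => Complex.exp (Complex.I * (∑ k ∈ Finset.range n, x n k : ℝ))
      - (∏ k ∈ Finset.range n, (1 + Complex.I * x n k)) * Complex.exp (-s / 2)) atTop (𝓝 0) := by
  -- Remainder in log(1 + ix) = ix + x²/2 + O(|x|³), so that exp(i∑x) = ∏(1 + ix) · exp(-∑x²/2 - R).
  set R : ℕ → ℂ := fun n => ∑ k ∈ Finset.range n,
    (Complex.log (1 + Complex.I * x n k) - (Complex.I * x n k + (x n k : ℂ) ^ 2 / 2)) with hR
  have hne : ∀ r : ℝ, (1 + Complex.I * r : ℂ) ≠ 0 := fun r h => by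
    have := congrArg Complex.re h
    simp at this
  have hrem : ∀ r : ℝ, |r| ≤ 1 / 2 →
      ‖Complex.log (1 + Complex.I * r) - (Complex.I * r + (r : ℂ) ^ 2 / 2)‖ ≤ |r| * r ^ 2 := by
    intro r hr
    have hn : ‖Complex.I * (r : ℂ)‖ = |r| := by simp
    have h := Complex.norm_log_sub_logTaylor_le 2 (z := Complex.I * r) (by rw [hn]; linarith)
    have ht : Complex.logTaylor (2 + 1) (Complex.I * r) = Complex.I * r + (r : ℂ) ^ 2 / 2 := by
      simp [Complex.logTaylor, Finset.sum_range_succ, mul_pow]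
      ring
    rw [ht, hn] at h
    refine h.trans ?_
    have h2 : (1 - |r|)⁻¹ ≤ 2 := by
      rw [inv_le_comm₀ (by linarith) (by norm_num)]
      linarith
    have h3 : |r| ^ (2 + 1) = |r| * r ^ 2 := by rw [pow_succ', sq_abs]
    rw [h3]
    have h4 : 0 ≤ |r| * r ^ 2 := by positivity
    have := mul_le_mul_of_nonneg_left h2 h4
    push_cast
    linarith
  have hR0 : Tendsto R atTop (𝓝 0) := by
    rw [Metric.tendsto_atTop']
    intro ε hε
    have hs0 : 0 ≤ s := ge_of_tendsto' hsq fun n => Finset.sum_nonneg fun _ _ => sq_nonneg _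
    -- The bound 1/2 makes the Taylor estimate available; the other one leaves ε/2 once the sum of
    -- squares is below s + 1.
    have hδ : 0 < min (1 / 2) (ε / (2 * (s + 1))) := by positivity
    obtain ⟨N, hN⟩ := eventually_atTop.1
      ((hmax _ hδ).and (hsq.eventually (gt_mem_nhds (lt_add_one s))))
    refine ⟨N, fun n hn => ?_⟩
    obtain ⟨h1, h2⟩ := hN n hn.le
    rw [dist_zero_right]
    calc ‖R n‖ ≤ ∑ k ∈ Finset.range n, ε / (2 * (s + 1)) * x n k ^ 2 := by
          refine norm_sum_le_of_le _ fun k hk => ?_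
          have hk' := h1 k (Finset.mem_range.1 hk)
          refine (hrem _ (hk'.trans (min_le_left _ _))).trans ?_
          exact mul_le_mul_of_nonneg_right (hk'.trans (min_le_right _ _)) (sq_nonneg _)
      _ = ε / (2 * (s + 1)) * ∑ k ∈ Finset.range n, x n k ^ 2 := by rw [Finset.mul_sum]
      _ ≤ ε / (2 * (s + 1)) * (s + 1) := by gcongr
      _ = ε / 2 := by field_simp
      _ < ε := half_lt_self hε
  have hexp : ∀ n, Complex.exp (Complex.I * (∑ k ∈ Finset.range n, x n k : ℝ))
      = (∏ k ∈ Finset.range n, (1 + Complex.I * x n k)) *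
        Complex.exp (-((∑ k ∈ Finset.range n, x n k ^ 2 : ℝ) : ℂ) / 2 - R n) := by
    intro n
    have hp : ∏ k ∈ Finset.range n, (1 + Complex.I * x n k)
        = Complex.exp (∑ k ∈ Finset.range n, Complex.log (1 + Complex.I * x n k)) := by
      rw [Complex.exp_sum]
      exact Finset.prod_congr rfl fun k _ => (Complex.exp_log (hne _)).symm
    rw [hp, ← Complex.exp_add]
    congr 1
    simp only [hR, Finset.sum_sub_distrib, Finset.sum_add_distrib, ← Finset.sum_div,
      ← Finset.mul_sum]
    push_cast
    ring
  have hlim : Tendsto (fun n => Complex.exp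
      (-((∑ k ∈ Finset.range n, x n k ^ 2 : ℝ) : ℂ) / 2 - R n) - Complex.exp (-s / 2))
      atTop (𝓝 0) := by
    have h1 : Tendsto (fun n => (-((∑ k ∈ Finset.range n, x n k ^ 2 : ℝ) : ℂ) / 2 - R n))
        atTop (𝓝 (-(s : ℂ) / 2 - 0)) :=
      (((Complex.continuous_ofReal.tendsto s).comp hsq).neg.div_const 2).sub hR0
    have h2 := ((Complex.continuous_exp.tendsto _).comp h1).sub_const (Complex.exp (-(s : ℂ) / 2))
    simpa using h2
  have hbd : ∀ᶠ n in atTop,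
      ‖∏ k ∈ Finset.range n, (1 + Complex.I * (x n k : ℂ))‖ ≤ Real.exp (s + 1) := by
    filter_upwards [hsq.eventually (gt_mem_nhds (lt_add_one s))] with n hn
    rw [norm_prod]
    calc ∏ k ∈ Finset.range n, ‖1 + Complex.I * (x n k : ℂ)‖
        ≤ ∏ k ∈ Finset.range n, Real.exp (x n k ^ 2) := by
          exact Finset.prod_le_prod (fun _ _ => norm_nonneg _) fun k _ =>
            norm_one_add_I_mul_le_exp _
      _ = Real.exp (∑ k ∈ Finset.range n, x n k ^ 2) := (Real.exp_sum _ _).symm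
      _ ≤ _ := Real.exp_le_exp.2 hn.le
  have := hlim.zero_mul_isBoundedUnder_le (g := fun n =>
    ∏ k ∈ Finset.range n, (1 + Complex.I * (x n k : ℂ)))
    ⟨Real.exp (s + 1), by simpa [Filter.eventually_map] using hbd⟩
  refine this.congr fun n => ?_
  rw [hexp]
  ring

/-- If `a n / n → 0` then `max_{k < n} a k` is `o(n)`. -/
lemma eventually_forall_lt_le_mul {a : ℕ → ℝ}
    (ha : Tendsto (fun n : ℕ => a n / (n + 1)) atTop (nhds 0)) {ε : ℝ} (hε : 0 < ε) :
    ∀ᶠ n : ℕ in atTop, ∀ k < n, a k ≤ ε * n := by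
  -- Terms beyond `K` satisfy a k ≤ ε(k + 1) ≤ εn; the finitely many earlier ones are bounded by a
  -- constant.
  obtain ⟨K, hK⟩ := eventually_atTop.1 (ha.eventually (gt_mem_nhds hε))
  obtain ⟨C, hC⟩ : ∃ C : ℝ, ∀ k < K, a k ≤ C :=
    ⟨∑ k ∈ Finset.range K, |a k|, fun k hk => (le_abs_self _).trans
      (Finset.single_le_sum (f := fun k => |a k|) (fun _ _ => abs_nonneg _)
        (Finset.mem_range.2 hk))⟩
  filter_upwards [tendsto_natCast_atTop_atTop.eventually_ge_atTop (C / ε)] with n hn k hk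
  rcases lt_or_ge k K with h | h
  · rw [div_le_iff₀ hε] at hn
    linarith [hC k h]
  · have h1 := (hK k h).le
    rw [div_le_iff₀ (by positivity)] at h1
    have : (k : ℝ) + 1 ≤ n := by exact_mod_cast hk
    nlinarith

/-- The terms of a sequence with convergent Cesàro means are `o(n)`. -/
lemma tendsto_div_of_tendsto_average {E : Type*} [NormedAddCommGroup E] [NormedSpace ℝ E]
    {a : ℕ → E} {s : E}
    (ha : Tendsto (fun n : ℕ => (n : ℝ)⁻¹ • ∑ k ∈ Finset.range n, a k) atTop (nhds s)) :
    Tendsto (fun n : ℕ => ((n : ℝ) + 1)⁻¹ • a n) atTop (nhds 0) := by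
  have h1 := (tendsto_add_atTop_iff_nat 1).2 ha
  -- With A_n the n-th mean, a_n/(n + 1) = A_{n+1} - (n/(n + 1)) A_n.
  have h2 : Tendsto (fun n : ℕ => ((n : ℝ) / (n + 1)) •
      ((n : ℝ)⁻¹ • ∑ k ∈ Finset.range n, a k)) atTop (nhds ((1 : ℝ) • s)) :=
    (tendsto_natCast_div_add_atTop (1 : ℝ)).smul ha
  have h3 := h1.sub h2
  rw [one_smul, sub_self] at h3
  refine h3.congr fun n => ?_
  rcases Nat.eq_zero_or_pos n with rfl | hn
  · simp
  · have : (n : ℝ) ≠ 0 := by positivity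
    rw [Finset.sum_range_succ, smul_smul, div_mul_eq_mul_div, mul_inv_cancel₀ this, one_div]
    push_cast
    rw [smul_add, add_sub_cancel_left]

/-- Bounded measurable functions are orthogonal to a function with zero integral on all
measurable sets. -/
lemma integral_mul_eq_zero_of_forall_setIntegral {Ω : Type*} {m mΩ : MeasurableSpace Ω}
    (hm : m ≤ mΩ)
    {Q : Measure Ω} [IsFiniteMeasure Q] {f : Ω → ℝ} (hf : Integrable f Q)
    (h0 : ∀ A, MeasurableSet[m] A → ∫ x in A, f x ∂Q = 0)
    {g : Ω → ℂ} (hg : StronglyMeasurable[m] g) {C : ℝ} (hgC : ∀ x, ‖g x‖ ≤ C) :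
    ∫ x, f x • g x ∂Q = 0 := by
  have hc : Q[f | m] =ᵐ[Q] 0 := by
    refine (ae_eq_condExp_of_forall_setIntegral_eq hm hf (g := 0)
      (fun _ _ _ => (integrable_zero _ _ _).integrableOn) (fun s hs _ => by rw [h0 s hs]; simp)
      aestronglyMeasurable_zero).symm
  have hi : Integrable (fun x => f x • g x) Q :=
    hf.smul_bdd C (hg.mono hm).aestronglyMeasurable (ae_of_all _ hgC)
  have := condExp_bilin_of_stronglyMeasurable_right (ContinuousLinearMap.lsmul ℝ ℝ (E := ℂ))
    hg hi hf
  rw [← integral_condExp hm]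
  refine (integral_congr_ae (g := 0) ?_).trans (by simp)
  refine this.trans ?_
  filter_upwards [hc] with x hx
  simp [hx]

/-! ### Martingale central limit theorem by McLeish's method -/

section MartingaleCLT

variable {Ω : Type*} {mΩ : MeasurableSpace Ω}

/-- The martingale differences `c * X k`, stopped once their sum of squares exceeds `C`. -/
noncomputable def stoppedDiff (X : ℕ → Ω → ℝ) (c C : ℝ) (k : ℕ) (x : Ω) : ℝ :=
  {y | c ^ 2 * ∑ j ∈ Finset.range k, X j y ^ 2 ≤ C}.indicator (fun y => c * X k y) x

lemma norm_one_add_I_mul_le (r : ℝ) : ‖1 + Complex.I * (r : ℂ)‖ ≤ 1 + |r| := by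
  refine (norm_add_le _ _).trans ?_
  simp

lemma norm_prod_one_add_stoppedDiff_le_exp (X : ℕ → Ω → ℝ) (c C : ℝ) (k : ℕ) {x : Ω}
    (hx : c ^ 2 * ∑ j ∈ Finset.range k, X j x ^ 2 ≤ C) :
    ‖∏ j ∈ Finset.range k, (1 + Complex.I * (stoppedDiff X c C j x : ℂ))‖ ≤ Real.exp C := by
  rw [norm_prod]
  calc ∏ j ∈ Finset.range k, ‖1 + Complex.I * (stoppedDiff X c C j x : ℂ)‖
      ≤ ∏ j ∈ Finset.range k, Real.exp (c ^ 2 * X j x ^ 2) := by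
        refine Finset.prod_le_prod (fun _ _ => norm_nonneg _) fun j _ => ?_
        refine (norm_one_add_I_mul_le_exp _).trans (Real.exp_le_exp.2 ?_)
        rw [stoppedDiff, Set.indicator_apply]
        split_ifs
        · rw [mul_pow]
        · simp only [ne_eq, OfNat.ofNat_ne_zero, not_false_eq_true, zero_pow]
          positivity
    _ = Real.exp (c ^ 2 * ∑ j ∈ Finset.range k, X j x ^ 2) := by
        rw [Finset.mul_sum, Real.exp_sum]
    _ ≤ _ := Real.exp_le_exp.2 hx

/-- The stopping test at k sees only the squares before k. The last unstopped factor therefore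
escapes the bound by `C`, and costs the extra 1 + S. -/
lemma norm_prod_one_add_stoppedDiff_le (X : ℕ → Ω → ℝ) (c : ℝ) {C : ℝ} (hC : 0 ≤ C) (n : ℕ)
    {x : Ω} {S : ℝ} (hS0 : 0 ≤ S) (hS : ∀ k < n, |c * X k x| ≤ S) :
    ‖∏ j ∈ Finset.range n, (1 + Complex.I * (stoppedDiff X c C j x : ℂ))‖
      ≤ Real.exp C * (1 + S) := by
  induction n with
  | zero =>
    simp only [Finset.range_zero, Finset.prod_empty, norm_one]
    nlinarith [Real.one_le_exp hC]
  | succ n ih =>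
    rw [Finset.prod_range_succ]
    by_cases h : c ^ 2 * ∑ j ∈ Finset.range n, X j x ^ 2 ≤ C
    · rw [norm_mul]
      refine mul_le_mul (norm_prod_one_add_stoppedDiff_le_exp X c C n h) ?_ (norm_nonneg _)
        (Real.exp_pos _).le
      refine (norm_one_add_I_mul_le _).trans ?_
      have : stoppedDiff X c C n x = c * X n x := Set.indicator_of_mem (by exact h) _
      rw [this]
      linarith [hS n n.lt_succ_self]
    · have : stoppedDiff X c C n x = 0 := Set.indicator_of_notMem (by exact h) _
      simpa [this] using ih fun k hk => hS k (hk.trans n.lt_succ_self)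

variable {Q : Measure Ω} [IsProbabilityMeasure Q] {ℱ : ℕ → MeasurableSpace Ω}

lemma measurable_stoppedDiff (hmono : Monotone ℱ) {X : ℕ → Ω → ℝ}
    (hX : ∀ k, Measurable[ℱ (k + 1)] (X k)) (c C : ℝ) (k : ℕ) :
    Measurable[ℱ (k + 1)] (stoppedDiff X c C k) := by
  refine Measurable.indicator ((hX k).const_mul c) ?_
  refine measurableSet_le (Measurable.const_mul ?_ _) measurable_const
  refine Finset.measurable_sum _ fun j hj => Measurable.pow_const ?_ _
  exact (hX j).mono (hmono (by have := Finset.mem_range.1 hj; omega)) le_rfl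

lemma measurable_prod_one_add_stoppedDiff (hmono : Monotone ℱ) {X : ℕ → Ω → ℝ}
    (hX : ∀ k, Measurable[ℱ (k + 1)] (X k)) (c C : ℝ) (k : ℕ) :
    Measurable[ℱ k] fun x =>
      ∏ j ∈ Finset.range k, (1 + Complex.I * (stoppedDiff X c C j x : ℂ)) := by
  refine Finset.measurable_prod _ fun j hj => Measurable.const_add (Measurable.const_mul ?_ _) _
  refine Complex.measurable_ofReal.comp ?_
  exact (measurable_stoppedDiff hmono hX c C j).mono (hmono (Finset.mem_range.1 hj)) le_rfl

/-- Passing from n to n + 1 adds X n times a function `g` that is `ℱ n`-measurable, and bounded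
because the product is at most exp C where stopping has not occurred. Such a term has zero integral.
-/
lemma integral_prod_one_add_stoppedDiff (hmono : Monotone ℱ) (hle : ∀ k, ℱ k ≤ mΩ)
    {X : ℕ → Ω → ℝ} (hX : ∀ k, Measurable[ℱ (k + 1)] (X k)) (hint : ∀ k, Integrable (X k) Q)
    (h0 : ∀ k A, MeasurableSet[ℱ k] A → ∫ x in A, X k x ∂Q = 0) (c C : ℝ) (n : ℕ) :
    Integrable (fun x => ∏ j ∈ Finset.range n, (1 + Complex.I * (stoppedDiff X c C j x : ℂ))) Q ∧
    ∫ x, ∏ j ∈ Finset.range n, (1 + Complex.I * (stoppedDiff X c C j x : ℂ)) ∂Q = 1 := by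
  induction n with
  | zero => simp
  | succ n ih =>
    set A : Set Ω := {y | c ^ 2 * ∑ j ∈ Finset.range n, X j y ^ 2 ≤ C} with hA
    set g : Ω → ℂ := fun x => A.indicator (fun x => (Complex.I * c) *
      ∏ j ∈ Finset.range n, (1 + Complex.I * (stoppedDiff X c C j x : ℂ))) x with hg
    have hAm : MeasurableSet[ℱ n] A := by
      refine measurableSet_le (Measurable.const_mul ?_ _) measurable_const
      refine Finset.measurable_sum _ fun j hj => Measurable.pow_const ?_ _
      exact (hX j).mono (hmono (Finset.mem_range.1 hj)) le_rfl
    have hgm : StronglyMeasurable[ℱ n] g :=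
      (((measurable_prod_one_add_stoppedDiff hmono hX c C n).const_mul _).indicator
        hAm).stronglyMeasurable
    have hgb : ∀ x, ‖g x‖ ≤ |c| * Real.exp C := by
      intro x
      rw [hg]
      by_cases hx : x ∈ A
      · simp only [Set.indicator_of_mem hx, norm_mul, Complex.norm_I, Complex.norm_real, one_mul,
          Real.norm_eq_abs]
        exact mul_le_mul_of_nonneg_left (norm_prod_one_add_stoppedDiff_le_exp X c C n hx)
          (abs_nonneg c)
      · simp only [Set.indicator_of_notMem hx, norm_zero]
        positivity
    have hsplit : ∀ x, ∏ j ∈ Finset.range (n + 1),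
        (1 + Complex.I * (stoppedDiff X c C j x : ℂ))
        = ∏ j ∈ Finset.range n, (1 + Complex.I * (stoppedDiff X c C j x : ℂ)) + X n x • g x := by
      intro x
      rw [Finset.prod_range_succ, mul_add, mul_one]
      congr 1
      by_cases hx : x ∈ A
      · have : stoppedDiff X c C n x = c * X n x := Set.indicator_of_mem hx _
        simp only [hg, Set.indicator_of_mem hx, this, Complex.real_smul]
        push_cast
        ring
      · have : stoppedDiff X c C n x = 0 := Set.indicator_of_notMem hx _
        simp [hg, Set.indicator_of_notMem hx, this]
    have hi : Integrable (fun x => X n x • g x) Q :=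
      (hint n).smul_bdd _ (hgm.mono (hle n)).aestronglyMeasurable (ae_of_all _ hgb)
    simp only [hsplit]
    refine ⟨ih.1.add hi, ?_⟩
    rw [integral_add ih.1 hi, ih.2,
      integral_mul_eq_zero_of_forall_setIntegral (hle n) (hint n) (h0 n) hgm hgb, add_zero]

/-- **Martingale central limit theorem**, in terms of characteristic functions: martingale
differences dominated by `√k S` with `S` integrable, whose squares have Cesàro means converging
almost surely to the constant `s`. -/
theorem tendsto_integral_exp_martingale (hmono : Monotone ℱ) (hle : ∀ k, ℱ k ≤ mΩ)
    {X : ℕ → Ω → ℝ} (hX : ∀ k, Measurable[ℱ (k + 1)] (X k))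
    (h0 : ∀ k A, MeasurableSet[ℱ k] A → ∫ x in A, X k x ∂Q = 0)
    {S : Ω → ℝ} (hS : Integrable S Q) (hXS : ∀ᵐ x ∂Q, ∀ k : ℕ, |X k x| ≤ √(k + 1) * S x)
    {s : ℝ} (hs : ∀ᵐ x ∂Q, Tendsto (fun n : ℕ => (n : ℝ)⁻¹ • ∑ k ∈ Finset.range n, X k x ^ 2)
      atTop (nhds s)) :
    Tendsto (fun n : ℕ => ∫ x, Complex.exp (Complex.I *
      (((√(n : ℝ))⁻¹ * ∑ k ∈ Finset.range n, X k x : ℝ) : ℂ)) ∂Q) atTop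
      (nhds (Complex.exp (-s / 2))) := by
  have hXm : ∀ k, Measurable (X k) := fun k => (hX k).mono (hle _) le_rfl
  have hint : ∀ k, Integrable (X k) Q := fun k => by
    refine (hS.const_mul √(k + 1)).mono' (hXm k).aestronglyMeasurable ?_
    filter_upwards [hXS] with x hx using hx k
  have hs0 : 0 ≤ s := by
    obtain ⟨x, hx⟩ := hs.exists
    exact ge_of_tendsto' hx fun n => smul_nonneg (by positivity)
      (Finset.sum_nonneg fun _ _ => sq_nonneg _)
  -- Any level above s works: the normalized squares tend to s, so at almost every point stopping
  -- eventually plays no role.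
  set C : ℝ := s + 1 with hC
  set Z : ℕ → Ω → ℂ := fun n x => ∏ j ∈ Finset.range n,
    (1 + Complex.I * (stoppedDiff X (√(n : ℝ))⁻¹ C j x : ℂ)) with hZ
  have hZi : ∀ n, Integrable (Z n) Q ∧ ∫ x, Z n x ∂Q = 1 := fun n =>
    integral_prod_one_add_stoppedDiff hmono hle hX hint h0 _ C n
  set E : ℕ → Ω → ℂ := fun n x => Complex.exp (Complex.I *
      (((√(n : ℝ))⁻¹ * ∑ k ∈ Finset.range n, X k x : ℝ) : ℂ)) with hE
  have hEm : ∀ n, Measurable (E n) := fun n => by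
    refine Complex.measurable_exp.comp (Measurable.const_mul (Complex.measurable_ofReal.comp ?_) _)
    exact Measurable.const_mul (Finset.measurable_sum _ fun j _ => hXm j) _
  have hEn : ∀ n x, ‖E n x‖ = 1 := fun n x => by
    simp only [hE]
    rw [mul_comm]
    exact Complex.norm_exp_ofReal_mul_I _
  have hEi : ∀ n, Integrable (E n) Q := fun n =>
    (integrable_const (1 : ℝ)).mono' (hEm n).aestronglyMeasurable
      (ae_of_all _ fun x => (hEn n x).le)
  have hdom : ∀ n, ∀ᵐ x ∂Q, ‖E n x - Z n x * Complex.exp (-s / 2)‖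
      ≤ 1 + Real.exp C * (1 + S x) := by
    intro n
    filter_upwards [hXS] with x hx
    have hSx : 0 ≤ S x := by simpa using (abs_nonneg _).trans (hx 0)
    refine (norm_sub_le _ _).trans (add_le_add (hEn n x).le ?_)
    rw [norm_mul]
    have h1 : ‖Complex.exp (-(s : ℂ) / 2)‖ ≤ 1 := by
      rw [Complex.norm_exp]
      have : (-(s : ℂ) / 2).re = -s / 2 := by simp
      rw [this]
      exact Real.exp_le_one_iff.2 (by linarith)
    have h2 : ‖Z n x‖ ≤ Real.exp C * (1 + S x) := by
      refine norm_prod_one_add_stoppedDiff_le X _ (by linarith) n hSx fun k hk => ?_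
      -- Here k + 1 ≤ n, so |X k|/√n ≤ √((k + 1)/n) S ≤ S.
      rw [abs_mul, abs_of_nonneg (by positivity)]
      have hn : (0 : ℝ) < n := by exact_mod_cast (Nat.zero_le k).trans_lt hk
      rw [inv_mul_le_iff₀ (Real.sqrt_pos.2 hn)]
      refine (hx k).trans (mul_le_mul_of_nonneg_right (Real.sqrt_le_sqrt ?_) hSx)
      exact_mod_cast hk
    nlinarith [norm_nonneg (Z n x), norm_nonneg (Complex.exp (-(s : ℂ) / 2))]
  have hlim : ∀ᵐ x ∂Q, Tendsto (fun n => E n x - Z n x * Complex.exp (-s / 2)) atTop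
      (nhds 0) := by
    filter_upwards [hs] with x hx
    have hsq : ∀ n : ℕ, ∑ k ∈ Finset.range n, ((√(n : ℝ))⁻¹ * X k x) ^ 2
        = (n : ℝ)⁻¹ • ∑ k ∈ Finset.range n, X k x ^ 2 := fun n => by
      simp only [mul_pow, ← Finset.mul_sum, inv_pow, Real.sq_sqrt (Nat.cast_nonneg n),
        smul_eq_mul]
    have hkey := tendsto_exp_sum_sub_prod_one_add (x := fun n k => (√(n : ℝ))⁻¹ * X k x) (s := s)
      (by
        intro ε hε
        have h1 := tendsto_div_of_tendsto_average hx
        have h2 := eventually_forall_lt_le_mul (a := fun n => X n x ^ 2) (by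
          simpa [div_eq_inv_mul] using h1) (pow_pos hε 2)
        filter_upwards [h2] with n hn k hk
        have hn0 : (0 : ℝ) < n := by exact_mod_cast (Nat.zero_le k).trans_lt hk
        refine abs_le_of_sq_le_sq ?_ hε.le
        rw [mul_pow, inv_pow, Real.sq_sqrt hn0.le, inv_mul_le_iff₀ hn0]
        linarith [hn k hk])
      (by simpa only [hsq] using hx)
    refine hkey.congr' ?_
    filter_upwards [hx.eventually (gt_mem_nhds (lt_add_one s))] with n hn
    have hZn : Z n x = ∏ k ∈ Finset.range n,
        (1 + Complex.I * (((√(n : ℝ))⁻¹ * X k x : ℝ) : ℂ)) := by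
      refine Finset.prod_congr rfl fun k hk => ?_
      congr 3
      refine Set.indicator_of_mem ?_ (fun y => (√(n : ℝ))⁻¹ * X k y)
      change _ ≤ C
      refine le_trans ?_ hn.le
      rw [inv_pow, Real.sq_sqrt (Nat.cast_nonneg n), smul_eq_mul]
      refine mul_le_mul_of_nonneg_left ?_ (by positivity)
      exact Finset.sum_le_sum_of_subset_of_nonneg
        (Finset.range_mono (Finset.mem_range.1 hk).le) fun _ _ _ => sq_nonneg _
    rw [hZn, ← Finset.mul_sum]
  have hmain := tendsto_integral_of_dominated_convergence
    (fun x => 1 + Real.exp C * (1 + S x))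
    (fun n => ((hEi n).sub ((hZi n).1.mul_const _)).aestronglyMeasurable)
    ((integrable_const _).add (((integrable_const _).add hS).const_mul _)) hdom hlim
  rw [integral_zero] at hmain
  have heq : ∀ n, ∫ x, (E n x - Z n x * Complex.exp (-s / 2)) ∂Q
      = ∫ x, E n x ∂Q - Complex.exp (-s / 2) := fun n => by
    rw [integral_sub (hEi n) ((hZi n).1.mul_const _), integral_mul_const, (hZi n).2, one_mul]
  exact tendsto_sub_nhds_zero_iff.1 (hmain.congr heq)

end MartingaleCLT

/-! ### Maximal inequality and approximation of rotated averages -/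

section PointwiseErgodic

variable {Ω : Type*} {mΩ : MeasurableSpace Ω} {μ : Measure Ω} {T : Ω → Ω}

/-- The running maximum `max (0, S₁, …, S_N)` of the Birkhoff sums of `φ`. -/
noncomputable def maxBirkhoffSum (T : Ω → Ω) (φ : Ω → ℝ) : ℕ → Ω → ℝ
  | 0 => fun _ => 0
  | N + 1 => fun x => max 0 (φ x + maxBirkhoffSum T φ N (T x))

lemma maxBirkhoffSum_nonneg (φ : Ω → ℝ) (N : ℕ) (x : Ω) : 0 ≤ maxBirkhoffSum T φ N x := by
  cases N with
  | zero => exact le_rfl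
  | succ N => exact le_max_left _ _

lemma maxBirkhoffSum_le_succ (φ : Ω → ℝ) (N : ℕ) (x : Ω) :
    maxBirkhoffSum T φ N x ≤ maxBirkhoffSum T φ (N + 1) x := by
  induction N generalizing x with
  | zero => exact le_max_left _ _
  | succ N ih => exact max_le_max le_rfl (add_le_add_right (ih (T x)) _)

lemma birkhoffSum_le_maxBirkhoffSum (φ : Ω → ℝ) (N : ℕ) (x : Ω) :
    birkhoffSum T φ N x ≤ maxBirkhoffSum T φ N x := by
  induction N generalizing x with
  | zero => simp [maxBirkhoffSum]
  | succ N ih =>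
    rw [birkhoffSum_succ']
    exact (add_le_add_right (ih (T x)) _).trans (le_max_right _ _)

lemma integrable_maxBirkhoffSum (hT : MeasurePreserving T μ μ) {φ : Ω → ℝ} (hφ : Integrable φ μ)
    (N : ℕ) : Integrable (maxBirkhoffSum T φ N) μ := by
  induction N with
  | zero => exact integrable_zero _ _ _
  | succ N ih =>
    exact (integrable_zero _ _ _).sup (hφ.add (hT.integrable_comp_of_integrable ih))

lemma measurable_maxBirkhoffSum (hT : Measurable T) {φ : Ω → ℝ} (hφ : Measurable φ)
    (N : ℕ) : Measurable (maxBirkhoffSum T φ N) := by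
  induction N with
  | zero => exact measurable_const
  | succ N ih => exact measurable_const.max (hφ.add (ih.comp hT))

/-- **Maximal ergodic theorem**. -/
lemma setIntegral_maxBirkhoffSum_pos_nonneg (hT : MeasurePreserving T μ μ) {φ : Ω → ℝ}
    (hφm : Measurable φ) (hφ : Integrable φ μ) (N : ℕ) :
    0 ≤ ∫ x in {x | 0 < maxBirkhoffSum T φ N x}, φ x ∂μ := by
  cases N with
  | zero => simp [maxBirkhoffSum]
  | succ N =>
    set M := maxBirkhoffSum T φ (N + 1) with hM
    set A : Set Ω := {x | 0 < M x} with hA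
    have hMi : Integrable M μ := integrable_maxBirkhoffSum hT hφ _
    have hMT : Integrable (M ∘ T) μ := hT.integrable_comp_of_integrable hMi
    have hMm : Measurable M := measurable_maxBirkhoffSum hT.measurable hφm _
    have hAm : MeasurableSet A := measurableSet_lt measurable_const hMm
    -- Garsia's argument: M vanishes off A, and on A one has M ≤ φ + M ∘ T. Integrating over A and
    -- using invariance of ∫ M gives the claim.
    have h1 : ∫ x in A, M x ∂μ = ∫ x, M x ∂μ := by
      refine setIntegral_eq_integral_of_forall_compl_eq_zero fun x hx => ?_
      exact le_antisymm (not_lt.1 hx) (maxBirkhoffSum_nonneg _ _ _)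
    have h2 : ∫ x in A, (M ∘ T) x ∂μ ≤ ∫ x, (M ∘ T) x ∂μ :=
      setIntegral_le_integral hMT (ae_of_all _ fun x => maxBirkhoffSum_nonneg _ _ _)
    have h3 : ∫ x, (M ∘ T) x ∂μ = ∫ x, M x ∂μ := by
      have h := integral_map (μ := μ) hT.measurable.aemeasurable (f := M)
        (by rw [hT.map_eq]; exact hMi.aestronglyMeasurable)
      rw [hT.map_eq] at h
      exact h.symm
    have h4 : ∫ x in A, (M x - (M ∘ T) x) ∂μ ≤ ∫ x in A, φ x ∂μ := by
      refine setIntegral_mono_on (hMi.sub hMT).integrableOn hφ.integrableOn hAm fun x hx => ?_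
      have hx' : 0 < M x := hx
      have : M x = φ x + maxBirkhoffSum T φ N (T x) := by
        rcases max_choice 0 (φ x + maxBirkhoffSum T φ N (T x)) with h | h
        · exact absurd (h : M x = 0) hx'.ne'
        · exact h
      have h5 : maxBirkhoffSum T φ N (T x) ≤ M (T x) := maxBirkhoffSum_le_succ φ N (T x)
      simp only [Function.comp_apply]
      linarith
    rw [integral_sub hMi.integrableOn hMT.integrableOn] at h4
    linarith

/-- The weak-type maximal inequality for Birkhoff averages. -/
lemma measure_exists_lt_birkhoffSum_le [IsFiniteMeasure μ] (hT : MeasurePreserving T μ μ)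
    {f : Ω → ℝ} (hfm : Measurable f) (hf : Integrable f μ) (hf0 : ∀ x, 0 ≤ f x)
    {r : ℝ} (hr : 0 < r) :
    μ {x | ∃ n : ℕ, n * r < birkhoffSum T f n x} ≤ ENNReal.ofReal ((∫ x, f x ∂μ) / r) := by
  set φ : Ω → ℝ := fun x => f x - r with hφ
  have hφi : Integrable φ μ := hf.sub (integrable_const r)
  set A : ℕ → Set Ω := fun N => {x | 0 < maxBirkhoffSum T φ N x} with hA
  have hsub : {x | ∃ n : ℕ, n * r < birkhoffSum T f n x} ⊆ ⋃ N, A N := by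
    rintro x ⟨n, hn⟩
    refine Set.mem_iUnion.2 ⟨n, ?_⟩
    refine lt_of_lt_of_le ?_ (birkhoffSum_le_maxBirkhoffSum φ n x)
    simp only [birkhoffSum, hφ, Finset.sum_sub_distrib, Finset.sum_const, Finset.card_range,
      nsmul_eq_mul] at hn ⊢
    linarith
  have hAmono : Monotone A := monotone_nat_of_le_succ fun N x hx =>
    lt_of_lt_of_le hx (maxBirkhoffSum_le_succ φ N x)
  have hAm : ∀ N, MeasurableSet (A N) := fun N => measurableSet_lt measurable_const
    (measurable_maxBirkhoffSum hT.measurable (hfm.sub_const r) N)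
  refine (measure_mono hsub).trans ?_
  rw [hAmono.measure_iUnion]
  refine iSup_le fun N => ?_
  rw [← ofReal_measureReal]
  refine ENNReal.ofReal_le_ofReal ?_
  rw [le_div_iff₀ hr]
  have h := setIntegral_maxBirkhoffSum_pos_nonneg hT (hfm.sub_const r) hφi N
  change 0 ≤ ∫ x in A N, (f x - r) ∂μ at h
  rw [integral_sub hf.integrableOn integrableOn_const, setIntegral_const, smul_eq_mul] at h
  have h2 : ∫ x in A N, f x ∂μ ≤ ∫ x, f x ∂μ :=
    setIntegral_le_integral hf (ae_of_all _ hf0)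
  linarith

/-- The rotated Birkhoff averages `n⁻¹ ∑_{k < n} z ^ k f (T ^ k x)`. -/
noncomputable def rotatedAverage (T : Ω → Ω) (z : ℂ) (f : Ω → ℂ) (n : ℕ) (x : Ω) : ℂ :=
  (n : ℝ)⁻¹ • ∑ k ∈ Finset.range n, z ^ k * f (T^[k] x)

lemma rotatedAverage_add (z : ℂ) (f g : Ω → ℂ) (n : ℕ) (x : Ω) :
    rotatedAverage T z (fun y => f y + g y) n x
      = rotatedAverage T z f n x + rotatedAverage T z g n x := by
  simp only [rotatedAverage, mul_add, Finset.sum_add_distrib, smul_add]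

lemma norm_rotatedAverage_le {z : ℂ} (hz : ‖z‖ = 1) (f : Ω → ℂ) (n : ℕ) (x : Ω) :
    ‖rotatedAverage T z f n x‖ ≤ (n : ℝ)⁻¹ * birkhoffSum T (fun y => ‖f y‖) n x := by
  rw [rotatedAverage, norm_smul, norm_inv, Real.norm_natCast, birkhoffSum]
  refine mul_le_mul_of_nonneg_left (norm_sum_le_of_le _ fun k _ => ?_) (by positivity)
  simp [hz]

/-- Almost everywhere convergence of rotated averages is preserved by `L¹` limits. -/
lemma ae_tendsto_rotatedAverage_of_approx [IsFiniteMeasure μ] (hT : MeasurePreserving T μ μ)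
    {z : ℂ} (hz : ‖z‖ = 1) {f : Ω → ℂ} (hfm : Measurable f) (hf : Integrable f μ) {c : ℂ}
    (h : ∀ δ > 0, ∃ (g : Ω → ℂ) (d : ℂ), Measurable g ∧ Integrable g μ ∧
      ∫ x, ‖f x - g x‖ ∂μ ≤ δ ∧ ‖d - c‖ ≤ δ ∧
      ∀ᵐ x ∂μ, Tendsto (fun n => rotatedAverage T z g n x) atTop (nhds d)) :
    ∀ᵐ x ∂μ, Tendsto (fun n => rotatedAverage T z f n x) atTop (nhds c) := by
  have hkey : ∀ ε > 0, ∀ᵐ x ∂μ, ∀ᶠ n in atTop, ‖rotatedAverage T z f n x - c‖ < ε := by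
    intro ε hε
    rw [ae_iff]
    refine le_antisymm (ENNReal.le_of_forall_pos_le_add fun η hη _ => ?_) zero_le
    rw [zero_add]
    have hη' : (0 : ℝ) < η := hη
    -- The first bound controls |d - c|; the second makes the maximal inequality for f - g at level
    -- ε/4 give measure at most η.
    obtain ⟨g, d, hgm, hgi, hfg, hd, hg⟩ := h (min (ε / 4) (η * (ε / 4))) (by positivity)
    have hm := measure_exists_lt_birkhoffSum_le hT (hfm.sub hgm).norm (hf.sub hgi).norm
      (fun x => norm_nonneg _) (r := ε / 4) (by positivity)
    have hsub : {x | ¬ ∀ᶠ n in atTop, ‖rotatedAverage T z f n x - c‖ < ε} ≤ᵐ[μ]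
        {x | ∃ n : ℕ, n * (ε / 4) < birkhoffSum T (fun x => ‖(f - g) x‖) n x} := by
      filter_upwards [hg] with x hx hbad
      by_contra hmax
      refine hbad ?_
      have hmax' : ∀ n : ℕ, birkhoffSum T (fun x => ‖(f - g) x‖) n x ≤ n * (ε / 4) := by
        intro n
        by_contra hn
        exact hmax ⟨n, not_le.1 hn⟩
      filter_upwards [Metric.tendsto_nhds.1 hx (ε / 4) (by positivity), eventually_gt_atTop 0]
        with n hn hn0
      have h1 : rotatedAverage T z f n x
          = rotatedAverage T z (f - g) n x + rotatedAverage T z g n x := by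
        rw [← rotatedAverage_add]
        simp
      have h2 : ‖rotatedAverage T z (f - g) n x‖ ≤ ε / 4 := by
        refine (norm_rotatedAverage_le hz _ n x).trans ?_
        rw [inv_mul_le_iff₀ (by exact_mod_cast hn0)]
        exact hmax' n
      have h3 : ‖d - c‖ ≤ ε / 4 := hd.trans (min_le_left _ _)
      rw [dist_eq_norm] at hn
      calc ‖rotatedAverage T z f n x - c‖
          = ‖rotatedAverage T z (f - g) n x + (rotatedAverage T z g n x - d) + (d - c)‖ := by
            rw [h1]; congr 1; ring
        _ ≤ ‖rotatedAverage T z (f - g) n x‖ + ‖rotatedAverage T z g n x - d‖ + ‖d - c‖ :=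
            norm_add₃_le
        _ < ε := by linarith
    refine (measure_mono_ae hsub).trans (hm.trans ?_)
    rw [← ENNReal.ofReal_coe_nnreal]
    refine ENNReal.ofReal_le_ofReal ?_
    rw [div_le_iff₀ (by positivity)]
    exact hfg.trans (min_le_right _ _)
  have hall : ∀ᵐ x ∂μ, ∀ m : ℕ, ∀ᶠ n in atTop,
      ‖rotatedAverage T z f n x - c‖ < 1 / ((m : ℝ) + 1) :=
    ae_all_iff.2 fun m => hkey _ (by positivity)
  filter_upwards [hall] with x hx
  rw [Metric.tendsto_nhds]
  intro ε hε
  obtain ⟨m, hm⟩ := exists_nat_one_div_lt hε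
  filter_upwards [hx m] with n hn
  rw [dist_eq_norm]
  exact hn.trans hm

/-- Cesàro means of a bounded sequence and of its averaged shifts are asymptotically equal. -/
lemma tendsto_average_sub_shift {b : ℕ → ℂ} {B : ℝ} (hb : ∀ k, ‖b k‖ ≤ B) (j : ℕ) :
    Tendsto (fun n : ℕ => (n : ℝ)⁻¹ • ∑ k ∈ Finset.range n, (b k - b (k + j))) atTop
      (nhds 0) := by
  induction j with
  | zero => simp
  | succ j ih =>
    -- Raising the shift by one adds a telescoping sum, of which only two bounded terms survive.
    have h : Tendsto (fun n : ℕ => (n : ℝ)⁻¹ • (b j - b (n + j))) atTop (nhds 0) := by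
      refine (tendsto_inv_atTop_nhds_zero_nat (𝕜 := ℝ)).zero_smul_isBoundedUnder_le ⟨B + B, ?_⟩
      rw [eventually_map]
      exact Eventually.of_forall fun n => norm_sub_le_of_le (hb _) (hb _)
    have := ih.add h
    rw [add_zero] at this
    refine this.congr fun n => ?_
    rw [← smul_add]
    congr 1
    have ht := Finset.sum_range_sub' (fun k => b (k + j)) n
    simp only [zero_add] at ht
    rw [← ht, ← Finset.sum_add_distrib]
    refine Finset.sum_congr rfl fun k _ => ?_
    rw [show k + 1 + j = k + (j + 1) by ring]
    ring

/-- With b_k = z^k g(T^k x), the k-th term of the sum is the mean over j < N of b_k - b_{k+j}, and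
bounded shifts do not change Cesàro limits. Convergence thus holds at every point. -/
lemma tendsto_rotatedAverage_sub_rotatedAverage {z : ℂ} (hz : ‖z‖ = 1) {g : Ω → ℂ} {B : ℝ}
    (hg : ∀ x, ‖g x‖ ≤ B) {N : ℕ} (hN : 0 < N) (x : Ω) :
    Tendsto (fun n => rotatedAverage T z (fun y => g y - rotatedAverage T z g N y) n x) atTop
      (nhds 0) := by
  set b : ℕ → ℂ := fun k => z ^ k * g (T^[k] x) with hb
  have hbB : ∀ k, ‖b k‖ ≤ B := fun k => by simpa [hb, hz] using hg _
  have h1 : Tendsto (fun n : ℕ => (N : ℝ)⁻¹ • ∑ j ∈ Finset.range N,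
      (n : ℝ)⁻¹ • ∑ k ∈ Finset.range n, (b k - b (k + j))) atTop (nhds 0) := by
    have := (tendsto_finsetSum (Finset.range N) fun j _ =>
      tendsto_average_sub_shift hbB j).const_smul (N : ℝ)⁻¹
    simpa using this
  refine h1.congr fun n => ?_
  rw [rotatedAverage, ← Finset.smul_sum, smul_comm, Finset.sum_comm, Finset.smul_sum]
  congr 1
  refine Finset.sum_congr rfl fun k _ => ?_
  have hNR : (N : ℝ) ≠ 0 := by exact_mod_cast hN.ne'
  rw [Finset.sum_sub_distrib, Finset.sum_const, Finset.card_range, smul_sub,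
    ← Nat.cast_smul_eq_nsmul ℝ, smul_smul, inv_mul_cancel₀ hNR, one_smul, mul_sub, rotatedAverage,
    mul_smul_comm,
    Finset.mul_sum]
  congr 2
  refine Finset.sum_congr rfl fun j _ => ?_
  simp only [hb]
  rw [← Function.iterate_add_apply, add_comm k j, pow_add]
  ring

lemma measurable_rotatedAverage (hT : Measurable T) (z : ℂ) {g : Ω → ℂ} (hg : Measurable g)
    (n : ℕ) : Measurable (rotatedAverage T z g n) := by
  have h : Measurable fun x => ∑ k ∈ Finset.range n, z ^ k * g (T^[k] x) :=
    Finset.measurable_sum _ fun k _ => (hg.comp (hT.iterate k)).const_mul _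
  exact h.const_smul (n : ℝ)⁻¹

lemma integrable_rotatedAverage (hT : MeasurePreserving T μ μ) (z : ℂ) {g : Ω → ℂ}
    (hg : Integrable g μ) (n : ℕ) : Integrable (rotatedAverage T z g n) μ := by
  have h : Integrable (fun x => ∑ k ∈ Finset.range n, z ^ k * g (T^[k] x)) μ :=
    integrable_finsetSum _ fun k _ =>
      ((hT.iterate k).integrable_comp_of_integrable hg).const_mul _
  exact h.smul (n : ℝ)⁻¹

end PointwiseErgodic

/-! ### Mean ergodic theorem and the rotated pointwise theorem -/

section PointwiseErgodic

variable {Ω : Type*} {mΩ : MeasurableSpace Ω} {μ : Measure Ω} {T : Ω → Ω}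

/-- The operator `h ↦ z h ∘ T` on `L²`. -/
noncomputable def rotatedKoopman (hT : MeasurePreserving T μ μ) (z : ℂ) :
    Lp ℂ 2 μ →L[ℂ] Lp ℂ 2 μ :=
  z • (Lp.compMeasurePreservingₗᵢ ℂ T hT).toContinuousLinearMap

lemma rotatedKoopman_apply (hT : MeasurePreserving T μ μ) (z : ℂ) (h : Lp ℂ 2 μ) :
    rotatedKoopman hT z h = z • Lp.compMeasurePreserving T hT h := rfl

lemma coeFn_rotatedKoopman (hT : MeasurePreserving T μ μ) (z : ℂ) (h : Lp ℂ 2 μ) :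
    rotatedKoopman hT z h =ᵐ[μ] fun x => z * h (T x) := by
  rw [rotatedKoopman_apply]
  filter_upwards [Lp.coeFn_smul z (Lp.compMeasurePreserving T hT h),
    Lp.coeFn_compMeasurePreserving h hT] with x h1 h2
  rw [h1, Pi.smul_apply, h2, smul_eq_mul, Function.comp_apply]

lemma norm_rotatedKoopman_le (hT : MeasurePreserving T μ μ) {z : ℂ} (hz : ‖z‖ = 1) :
    ‖rotatedKoopman hT z‖ ≤ 1 := by
  refine ContinuousLinearMap.opNorm_le_bound _ zero_le_one fun h => ?_
  rw [rotatedKoopman_apply, norm_smul, hz, Lp.norm_compMeasurePreserving]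

lemma coeFn_rotatedKoopman_iterate (hT : MeasurePreserving T μ μ) (z : ℂ) {g : Ω → ℂ}
    (hg : MemLp g 2 μ) (k : ℕ) :
    (rotatedKoopman hT z)^[k] (hg.toLp g) =ᵐ[μ] fun x => z ^ k * g (T^[k] x) := by
  induction k with
  | zero => simpa using hg.coeFn_toLp
  | succ k ih =>
    rw [Function.iterate_succ_apply']
    refine (coeFn_rotatedKoopman hT z _).trans ?_
    filter_upwards [hT.quasiMeasurePreserving.ae ih] with x hx
    rw [hx, Function.iterate_succ_apply]
    ring

lemma coeFn_birkhoffAverage_rotatedKoopman (hT : MeasurePreserving T μ μ) (z : ℂ) {g : Ω → ℂ}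
    (hg : MemLp g 2 μ) (N : ℕ) :
    (birkhoffAverage ℂ (rotatedKoopman hT z) _root_.id N (hg.toLp g) : Lp ℂ 2 μ)
      =ᵐ[μ] rotatedAverage T z g N := by
  have hsum : ∀ N, (∑ k ∈ Finset.range N, (rotatedKoopman hT z)^[k] (hg.toLp g) : Lp ℂ 2 μ)
      =ᵐ[μ] fun x => ∑ k ∈ Finset.range N, z ^ k * g (T^[k] x) := by
    intro N
    induction N with
    | zero =>
      simp only [Finset.range_zero, Finset.sum_empty]
      exact Lp.coeFn_zero ℂ 2 μ
    | succ N ih =>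
      simp only [Finset.sum_range_succ]
      refine (Lp.coeFn_add _ _).trans ?_
      filter_upwards [ih, coeFn_rotatedKoopman_iterate hT z hg N] with x h1 h2
      rw [Pi.add_apply, h1, h2]
  simp only [birkhoffAverage, birkhoffSum, id_eq]
  refine (Lp.coeFn_smul _ _).trans ?_
  filter_upwards [hsum N] with x hx
  rw [Pi.smul_apply, hx, rotatedAverage, smul_eq_mul, Complex.real_smul]
  push_cast
  rfl

lemma integral_norm_le_norm_Lp_two [IsProbabilityMeasure μ] (h : Lp ℂ 2 μ) :
    ∫ x, ‖h x‖ ∂μ ≤ ‖h‖ := by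
  rw [integral_norm_eq_lintegral_enorm (Lp.aestronglyMeasurable h),
    ← eLpNorm_one_eq_lintegral_enorm,
    Lp.norm_def]
  refine ENNReal.toReal_mono (Lp.eLpNorm_ne_top h) ?_
  exact eLpNorm_le_eLpNorm_of_exponent_le (by norm_num) (Lp.aestronglyMeasurable h)

/-- The condition a z = a means z = 1 or a = 0, so a single argument serves both Birkhoff's theorem
(a = 1) and the case of limit zero (a = 0). -/
lemma mul_integral_rotatedAverage (hT : MeasurePreserving T μ μ) {z a : ℂ} (haz : a * z = a)
    {g : Ω → ℂ} (hg : Integrable g μ) {n : ℕ} (hn : 0 < n) :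
    a * ∫ x, rotatedAverage T z g n x ∂μ = a * ∫ x, g x ∂μ := by
  have hazk : ∀ k : ℕ, a * z ^ k = a := fun k => by
    induction k with
    | zero => simp
    | succ k ih => rw [pow_succ, ← mul_assoc, ih, haz]
  have hk : ∀ k : ℕ, ∫ x, g (T^[k] x) ∂μ = ∫ x, g x ∂μ := fun k => by
    have h := integral_map (μ := μ) (hT.iterate k).measurable.aemeasurable (f := g)
      (by rw [(hT.iterate k).map_eq]; exact hg.aestronglyMeasurable)
    rw [(hT.iterate k).map_eq] at h
    exact h.symm
  have hki : ∀ k ∈ Finset.range n, Integrable (fun x => z ^ k * g (T^[k] x)) μ := fun k _ =>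
    ((hT.iterate k).integrable_comp_of_integrable hg).const_mul _
  simp only [rotatedAverage]
  rw [integral_smul, integral_finsetSum _ hki]
  rw [mul_smul_comm, Finset.mul_sum]
  have : ∀ k ∈ Finset.range n, a * ∫ x, z ^ k * g (T^[k] x) ∂μ = a * ∫ x, g x ∂μ :=
    fun k _ => by rw [integral_const_mul, hk, ← mul_assoc, hazk]
  rw [Finset.sum_congr rfl this, Finset.sum_const, Finset.card_range,
    ← Nat.cast_smul_eq_nsmul ℝ, smul_smul, inv_mul_cancel₀ (by exact_mod_cast hn.ne'), one_smul]

/-- `L²` (hence `L¹`) convergence of rotated averages of bounded functions. -/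
lemma exists_integral_norm_rotatedAverage_sub_le [IsProbabilityMeasure μ]
    (hT : MeasurePreserving T μ μ) {z a : ℂ} (hz : ‖z‖ = 1) (haz : a * z = a)
    (hfix : ∀ h : Lp ℂ 2 μ, rotatedKoopman hT z h = h → h =ᵐ[μ] fun _ => a * ∫ x, h x ∂μ)
    {g : Ω → ℂ} (hgm : Measurable g) {B : ℝ} (hgB : ∀ x, ‖g x‖ ≤ B) {δ : ℝ} (hδ : 0 < δ) :
    ∃ N > 0, ∫ x, ‖rotatedAverage T z g N x - a * ∫ y, g y ∂μ‖ ∂μ ≤ δ := by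
  have hgL : MemLp g 2 μ := MemLp.of_bound hgm.aestronglyMeasurable B (ae_of_all _ hgB)
  have hgi : Integrable g μ := hgL.integrable (by norm_num)
  set V := rotatedKoopman hT z with hV
  set G := hgL.toLp g
  -- Von Neumann's theorem gives convergence to the projection on the fixed vectors, which `hfix`
  -- identifies as constants.
  have hlim := V.tendsto_birkhoffAverage_orthogonalProjection (norm_rotatedKoopman_le hT hz) G
  set p := (V.eqLocus (1 : Lp ℂ 2 μ →L[ℂ] Lp ℂ 2 μ)).orthogonalProjectionOnto G
  set Q : Lp ℂ 2 μ := (p : Lp ℂ 2 μ) with hQ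
  have hQfix : V Q = Q := p.2
  have hQc := hfix Q hQfix
  have hQi : Integrable Q μ := (Lp.memLp Q).integrable (by norm_num)
  have hbound : ∀ n, ∫ x, ‖rotatedAverage T z g n x - Q x‖ ∂μ
      ≤ ‖birkhoffAverage ℂ V _root_.id n G - Q‖ := fun n => by
    refine le_trans (le_of_eq ?_) (integral_norm_le_norm_Lp_two _)
    refine integral_congr_ae ?_
    filter_upwards [coeFn_birkhoffAverage_rotatedKoopman hT z hgL n,
      Lp.coeFn_sub (birkhoffAverage ℂ V _root_.id n G) Q] with x h1 h2
    rw [h2, Pi.sub_apply, h1]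
  have hnorm : Tendsto (fun n => ‖birkhoffAverage ℂ V _root_.id n G - Q‖) atTop (nhds 0) :=
    tendsto_iff_norm_sub_tendsto_zero.1 hlim
  have h1 : Tendsto (fun n => ∫ x, ‖rotatedAverage T z g n x - Q x‖ ∂μ) atTop (nhds 0) :=
    squeeze_zero (fun n => integral_nonneg fun _ => norm_nonneg _) hbound hnorm
  have h2 : Tendsto (fun n => ∫ x, rotatedAverage T z g n x ∂μ) atTop (nhds (∫ x, Q x ∂μ)) := by
    rw [tendsto_iff_norm_sub_tendsto_zero]
    refine squeeze_zero (fun n => norm_nonneg _) (fun n => ?_) h1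
    rw [← integral_sub (integrable_rotatedAverage hT z hgi n) hQi]
    exact norm_integral_le_integral_norm _
  have hmean : a * ∫ x, Q x ∂μ = a * ∫ x, g x ∂μ := by
    refine tendsto_nhds_unique (h2.const_mul a) (tendsto_const_nhds.congr' ?_)
    filter_upwards [eventually_gt_atTop 0] with n hn
    exact (mul_integral_rotatedAverage hT haz hgi hn).symm
  obtain ⟨N, hN, hN0⟩ := ((h1.eventually (gt_mem_nhds hδ)).and (eventually_gt_atTop 0)).exists
  refine ⟨N, hN0, le_trans (le_of_eq (integral_congr_ae ?_)) hN.le⟩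
  filter_upwards [hQc] with x hx
  rw [hx, hmean]

/-- Rotated pointwise ergodic theorem. If the only fixed points of `h ↦ z h ∘ T` in `L²` are
the constants `a ∫ h`, then the rotated averages of `f ∈ L¹` converge to `a ∫ f`. -/
theorem ae_tendsto_rotatedAverage [IsProbabilityMeasure μ]
    (hT : MeasurePreserving T μ μ) {z a : ℂ} (hz : ‖z‖ = 1) (haz : a * z = a)
    (hfix : ∀ h : Lp ℂ 2 μ, rotatedKoopman hT z h = h → h =ᵐ[μ] fun _ => a * ∫ x, h x ∂μ)
    {f : Ω → ℂ} (hfm : Measurable f) (hf : Integrable f μ) :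
    ∀ᵐ x ∂μ, Tendsto (fun n => rotatedAverage T z f n x) atTop (nhds (a * ∫ x, f x ∂μ)) := by
  refine ae_tendsto_rotatedAverage_of_approx hT hz hfm hf fun δ hδ => ?_
  -- Two L¹ errors of size η must add up to at most δ, and ‖a‖ η must bound the error in the limit
  -- constant.
  set η : ℝ := δ / (2 * (1 + ‖a‖)) with hη
  have hη0 : 0 < η := by positivity
  have hηδ : η ≤ δ / 2 ∧ ‖a‖ * η ≤ δ := by
    have h1 : η * (2 * (1 + ‖a‖)) = δ := div_mul_cancel₀ _ (by positivity)
    constructor <;> nlinarith [mul_nonneg (norm_nonneg a) hη0.le]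
  obtain ⟨g, hg, -⟩ := (memLp_one_iff_integrable.2 hf).exists_simpleFunc_eLpNorm_sub_lt
    ENNReal.one_ne_top (ε := ENNReal.ofReal η) (by simpa using hη0)
  obtain ⟨B, hB⟩ := g.exists_forall_norm_le
  have hgm : Measurable g := g.measurable
  have hgi : Integrable g μ := (integrable_const B).mono' hgm.aestronglyMeasurable (ae_of_all _ hB)
  have hfg : ∫ x, ‖f x - g x‖ ∂μ ≤ η := by
    have h := integral_norm_eq_lintegral_enorm (hf.sub hgi).aestronglyMeasurable
    rw [eLpNorm_one_eq_lintegral_enorm] at hg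
    exact h.trans_le <| ENNReal.toReal_le_of_le_ofReal hη0.le hg.le
  obtain ⟨N, hN, hgN⟩ := exists_integral_norm_rotatedAverage_sub_le hT hz haz hfix hgm hB hη0
  set d : ℂ := a * ∫ y, g y ∂μ with hd
  have hdz : ∀ k : ℕ, z ^ k * d = d := fun k => by
    induction k with
    | zero => simp
    | succ k ih => 
      rw [pow_succ, mul_assoc, show z * d = d by rw [hd, ← mul_assoc, mul_comm z, haz], ih]
  have hAi := integrable_rotatedAverage hT z hgi N
  -- The averages of g - A_N g tend to 0 everywhere, while the constant `d` is reproduced because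
  -- z^k d = d.
  refine ⟨fun x => (g x - rotatedAverage T z g N x) + d, d,
    (hgm.sub (measurable_rotatedAverage hT.measurable z hgm N)).add_const d,
    (hgi.sub hAi).add (integrable_const d), ?_, ?_, ae_of_all _ fun x => ?_⟩
  · calc ∫ x, ‖f x - (g x - rotatedAverage T z g N x + d)‖ ∂μ
        ≤ ∫ x, (‖f x - g x‖ + ‖rotatedAverage T z g N x - d‖) ∂μ := by
          refine integral_mono (hf.sub ((hgi.sub hAi).add (integrable_const d))).norm
            ((hf.sub hgi).norm.add (hAi.sub (integrable_const d)).norm) fun x => ?_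
          refine le_trans (le_of_eq ?_) (norm_add_le _ _)
          congr 1
          ring
      _ = ∫ x, ‖f x - g x‖ ∂μ + ∫ x, ‖rotatedAverage T z g N x - d‖ ∂μ :=
          integral_add (hf.sub hgi).norm (hAi.sub (integrable_const d)).norm
      _ ≤ δ := by linarith [hηδ.1]
  · rw [hd, ← mul_sub, norm_mul, ← integral_sub hgi hf]
    refine le_trans (mul_le_mul_of_nonneg_left ?_ (norm_nonneg a)) hηδ.2
    refine (norm_integral_le_integral_norm _).trans (le_trans (le_of_eq ?_) hfg)
    exact integral_congr_ae (ae_of_all _ fun x => norm_sub_rev _ _)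
  · have h1 := tendsto_rotatedAverage_sub_rotatedAverage (T := T) hz hB hN x
    have h2 := h1.add_const d
    rw [zero_add] at h2
    refine h2.congr' ?_
    filter_upwards [eventually_gt_atTop 0] with n hn
    rw [rotatedAverage_add]
    congr 1
    simp only [rotatedAverage, hdz]
    rw [Finset.sum_const, Finset.card_range, ← Nat.cast_smul_eq_nsmul ℝ, smul_smul,
      inv_mul_cancel₀ (by exact_mod_cast hn.ne'), one_smul]

/-- **Birkhoff's pointwise ergodic theorem**. -/
theorem Ergodic.ae_tendsto_average [IsProbabilityMeasure μ] (hT : Ergodic T μ)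
    {f : Ω → ℂ} (hfm : Measurable f) (hf : Integrable f μ) :
    ∀ᵐ x ∂μ, Tendsto (fun n => rotatedAverage T 1 f n x) atTop (nhds (∫ x, f x ∂μ)) := by
  have h := ae_tendsto_rotatedAverage hT.toMeasurePreserving (z := 1) (a := 1) (by simp) (by simp)
    (fun h hh => by
      have h1 := coeFn_rotatedKoopman hT.toMeasurePreserving 1 h
      rw [hh] at h1
      obtain ⟨c, hc⟩ := hT.ae_eq_const_of_ae_eq_comp_ae (Lp.aestronglyMeasurable h) (by
        filter_upwards [h1] with x hx
        rw [Function.comp_apply, hx, one_mul])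
      have h2 : ∫ x, h x ∂μ = c := by
        rw [integral_congr_ae hc]
        simp
      filter_upwards [hc] with x hx
      rw [hx, h2, one_mul, Function.const_apply]) hfm hf
  simpa only [one_mul] using h

/-- If `z⁻¹` is not an eigenvalue of `T`, the rotated averages of an integrable function
converge to zero. -/
theorem ae_tendsto_rotatedAverage_zero [IsProbabilityMeasure μ] (hT : MeasurePreserving T μ μ)
    {z : ℂ} (hz : ‖z‖ = 1) (hev : ¬ IsKoopmanEigenvalue hT z⁻¹)
    {f : Ω → ℂ} (hfm : Measurable f) (hf : Integrable f μ) :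
    ∀ᵐ x ∂μ, Tendsto (fun n => rotatedAverage T z f n x) atTop (nhds 0) := by
  have hz0 : z ≠ 0 := fun h => by simp [h] at hz
  have h := ae_tendsto_rotatedAverage hT hz (a := 0) (by simp)
    (fun h hh => by
      have h0 : h = 0 := by
        by_contra hne
        refine hev (Module.End.hasEigenvalue_of_hasEigenvector (x := h)
          ⟨Module.End.mem_eigenspace_iff.2 ?_, hne⟩)
        rw [rotatedKoopman_apply] at hh
        rw [eq_inv_smul_iff₀ hz0]
        exact hh
      rw [h0]
      filter_upwards [Lp.coeFn_zero ℂ 2 μ] with x hx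
      rw [hx, zero_mul, Pi.zero_apply]) hfm hf
  simpa only [zero_mul] using h

end PointwiseErgodic

/-! ### Transfer to regular conditional probabilities -/

section RegularConditionalProbability

/-- Fubini's theorem for the composition of a measure with a kernel. -/
lemma integrable_and_integral_bind_kernel {α β : Type*} {mα : MeasurableSpace α}
    {mβ : MeasurableSpace β} {μ : Measure α} {η : Kernel α β} {f : β → ℂ}
    (hf : Integrable f (μ.bind η)) :
    Integrable (fun a => ∫ b, f b ∂(η a)) μ ∧ ∫ b, f b ∂(μ.bind η) = ∫ a, ∫ b, f b ∂(η a) ∂μ := by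
  rw [Measure.comp_eq_comp_const_apply] at hf ⊢
  have h1 := hf.integral_comp
  have h2 := Kernel.integral_comp hf
  rw [Kernel.const_apply] at h1 h2
  exact ⟨h1, h2⟩

variable {Ω : Type*} {F₀ mΩ : MeasurableSpace Ω} {P : Measure Ω} [IsProbabilityMeasure P]
  {κ : @Kernel Ω Ω F₀ mΩ} [∀ ω, IsProbabilityMeasure (κ ω)]

/-- A regular conditional probability disintegrates the restriction of `P` to any set of the
conditioning σ-algebra. -/
lemma IsRegularCondProb.bind_restrict (hκ : IsRegularCondProb P κ) (hF₀ : F₀ ≤ mΩ) {A : Set Ω}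
    (hA : MeasurableSet[F₀] A) : (P.restrict A).bind κ = P.restrict A := by
  have hκm : Measurable (fun ω => κ ω) := κ.measurable.mono hF₀ le_rfl
  ext B hB
  rw [Measure.bind_apply hB hκm.aemeasurable, Measure.restrict_apply hB]
  have hBi : Integrable (B.indicator fun _ => (1 : ℝ)) P :=
    (integrable_const (1 : ℝ)).indicator hB
  have hint : Integrable (fun ω => (κ ω).real B) P :=
    integrable_condExp.congr (hκ B hB).symm
  have h1 : ∫ ω in A, (κ ω).real B ∂P = P.real (B ∩ A) := by
    rw [setIntegral_congr_ae (g := P⟦B | F₀⟧) (hF₀ A hA)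
      ((hκ B hB).mono fun ω h _ => h), setIntegral_condExp hF₀ hBi hA,
      integral_indicator hB, Measure.restrict_restrict hB]
    simp
  have h2 : ∀ ω, κ ω B = ENNReal.ofReal ((κ ω).real B) := fun ω =>
    (ofReal_measureReal (μ := κ ω)).symm
  simp only [h2]
  rw [← ofReal_integral_eq_lintegral_ofReal hint.integrableOn
    (ae_of_all _ fun _ => measureReal_nonneg), h1, ofReal_measureReal]

lemma IsRegularCondProb.bind_eq (hκ : IsRegularCondProb P κ) (hF₀ : F₀ ≤ mΩ) :
    P.bind κ = P := by
  simpa using hκ.bind_restrict hF₀ (A := Set.univ) MeasurableSet.univ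

lemma IsRegularCondProb.ae_ae (hκ : IsRegularCondProb P κ) (hF₀ : F₀ ≤ mΩ) {p : Ω → Prop}
    (h : ∀ᵐ x ∂P, p x) : ∀ᵐ ω ∂P, ∀ᵐ x ∂(κ ω), p x := by
  rw [← hκ.bind_eq hF₀] at h
  exact Measure.ae_ae_of_ae_bind (κ.measurable.mono hF₀ le_rfl).aemeasurable h

lemma IsRegularCondProb.ae_lintegral_lt_top (hκ : IsRegularCondProb P κ) (hF₀ : F₀ ≤ mΩ)
    {W : Ω → ENNReal} (hW : Measurable W) (h : ∫⁻ x, W x ∂P ≠ ⊤) :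
    ∀ᵐ ω ∂P, ∫⁻ x, W x ∂(κ ω) < ⊤ := by
  have hκm : Measurable (fun ω => κ ω) := κ.measurable.mono hF₀ le_rfl
  refine ae_lt_top ((Measure.measurable_lintegral hW).comp hκm) ?_
  have := Measure.lintegral_bind (m := P) (μ := fun ω => κ ω) (f := W) hκm.aemeasurable
    hW.aemeasurable
  rw [hκ.bind_eq hF₀] at this
  exact this ▸ h

/-- A function with zero integral on the sets of the conditioning σ-algebra has zero integral
under almost every conditional probability. -/
lemma IsRegularCondProb.ae_integral_eq_zero (hκ : IsRegularCondProb P κ) (hF₀ : F₀ ≤ mΩ)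
    {f : Ω → ℂ} (hfm : Measurable f) (hf : Integrable f P)
    (h0 : ∀ A, MeasurableSet[F₀] A → ∫ x in A, f x ∂P = 0) :
    ∀ᵐ ω ∂P, ∫ x, f x ∂(κ ω) = 0 := by
  -- The same family as a kernel from the full σ-algebra, on which P lives; the F₀-measurability of
  -- `κ` is used again in `hhm`.
  obtain ⟨κ', hκ'⟩ : ∃ κ' : @Kernel Ω Ω mΩ mΩ, ∀ ω, κ' ω = κ ω :=
    ⟨@Kernel.mk Ω Ω mΩ mΩ (fun ω => κ ω) (κ.measurable.mono hF₀ le_rfl), fun _ => rfl⟩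
  have hfun : (fun ω => κ ω) = fun ω => κ' ω := funext fun ω => (hκ' ω).symm
  have hbind : ∀ A, MeasurableSet[F₀] A → (P.restrict A).bind (fun ω => κ' ω) = P.restrict A :=
    fun A hA => by
      rw [← hfun]
      exact hκ.bind_restrict hF₀ hA
  have hA : ∀ A, MeasurableSet[F₀] A → IntegrableOn (fun ω => ∫ x, f x ∂(κ ω)) A P ∧
      ∫ ω in A, ∫ x, f x ∂(κ ω) ∂P = 0 := fun A hA => by
    have h := integrable_and_integral_bind_kernel (μ := P.restrict A) (η := κ') (f := f)
      (by rw [hbind A hA]; exact hf.integrableOn)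
    rw [hbind A hA, h0 A hA] at h
    simp only [hκ'] at h
    exact ⟨h.1, h.2.symm⟩
  have hhm : StronglyMeasurable[F₀] fun ω => ∫ x, f x ∂(κ ω) :=
    StronglyMeasurable.integral_kernel (κ := κ) hfm.stronglyMeasurable
  refine ae_eq_of_forall_setIntegral_eq_of_sigmaFinite' hF₀ (g := fun _ => (0 : ℂ))
    (fun A h _ => (hA A h).1) (fun _ _ _ => (integrable_zero _ _ _).integrableOn)
    (fun A h _ => ?_) hhm.aestronglyMeasurable aestronglyMeasurable_const
  rw [integral_zero, (hA A h).2]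

/-- A σ-algebra that is countably generated is generated by a countable π-system of measurable
sets containing the whole space. -/
lemma exists_countable_isPiSystem_generateFrom {α : Type*} (m : MeasurableSpace α)
    [MeasurableSpace.CountablyGenerated α] :
    ∃ S : Set (Set α), S.Countable ∧ IsPiSystem S ∧ m = MeasurableSpace.generateFrom S ∧
      Set.univ ∈ S := by
  have hA : IsSetAlgebra (generateSetAlgebra (MeasurableSpace.countableGeneratingSet α)) :=
    isSetAlgebra_generateSetAlgebra
  refine ⟨generateSetAlgebra (MeasurableSpace.countableGeneratingSet α),
    countable_generateSetAlgebra MeasurableSpace.countable_countableGeneratingSet,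
    fun s hs t ht _ => hA.inter_mem hs ht, ?_, hA.univ_mem⟩
  rw [generateFrom_generateSetAlgebra_eq, MeasurableSpace.generateFrom_countableGeneratingSet]

/-- Vanishing of the integral on a generating π-system implies vanishing on the σ-algebra. -/
lemma setIntegral_eq_zero_of_isPiSystem {α : Type*} {m m0 : MeasurableSpace α} (hm : m ≤ m0)
    {Q : Measure α} {S : Set (Set α)} (hS : IsPiSystem S)
    (hgen : m = MeasurableSpace.generateFrom S) (huniv : Set.univ ∈ S) {f : α → ℂ}
    (hf : Integrable f Q) (h0 : ∀ A ∈ S, ∫ x in A, f x ∂Q = 0) {A : Set α}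
    (hA : MeasurableSet[m] A) : ∫ x in A, f x ∂Q = 0 := by
  have htot : ∫ x, f x ∂Q = 0 := by simpa using h0 _ huniv
  induction A, hA using MeasurableSpace.induction_on_inter hgen hS with
  | empty => simp
  | basic A hA => exact h0 A hA
  | compl A hA ih =>
    have := integral_add_compl (hm A hA) hf
    rwa [ih, zero_add, htot] at this
  | iUnion s hd hs ih =>
    rw [integral_iUnion (fun i => hm _ (hs i)) hd hf.integrableOn]
    simp [ih]

end RegularConditionalProbability

/-- Conditional orthogonality to a countably generated σ-algebra passes to almost every
conditional probability. -/
lemma IsRegularCondProb.ae_forall_setIntegral_eq_zero {Ω : Type*}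
    {m F₀ mΩ : MeasurableSpace Ω} {P : Measure Ω} [IsProbabilityMeasure P]
    {κ : @Kernel Ω Ω F₀ mΩ} [∀ ω, IsProbabilityMeasure (κ ω)]
    (hκ : IsRegularCondProb P κ) (hF₀ : F₀ ≤ mΩ) (hm : m ≤ mΩ)
    (hcg : @MeasurableSpace.CountablyGenerated Ω m)
    {f : Ω → ℂ} (hfm : Measurable f) (hf : Integrable f P)
    (h0 : ∀ A C, MeasurableSet[m] A → MeasurableSet[F₀] C → ∫ x in C ∩ A, f x ∂P = 0) :
    ∀ᵐ ω ∂P, Integrable f (κ ω) → ∀ A, MeasurableSet[m] A → ∫ x in A, f x ∂(κ ω) = 0 := by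
  obtain ⟨S, hSc, hSpi, hSgen, hSu⟩ := @exists_countable_isPiSystem_generateFrom Ω m hcg
  have hSm : ∀ A ∈ S, MeasurableSet[m] A := fun A hA => by
    rw [hSgen]
    exact MeasurableSpace.measurableSet_generateFrom hA
  -- Each A costs a null set, so only the countable π-system is treated here. Integrability under `κ
  -- ω` enters only in the extension to the whole σ-algebra.
  have hall : ∀ᵐ ω ∂P, ∀ A ∈ S, ∫ x in A, f x ∂(κ ω) = 0 := by
    refine (ae_ball_iff hSc).2 fun A hA => ?_
    have hAm := hm A (hSm A hA)
    have := hκ.ae_integral_eq_zero hF₀ (hfm.indicator hAm) (hf.indicator hAm) fun C hC => by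
      rw [setIntegral_indicator hAm]
      exact h0 A C (hSm A hA) hC
    filter_upwards [this] with ω hω
    rwa [integral_indicator hAm] at hω
  filter_upwards [hall] with ω hω hi A hA
  exact setIntegral_eq_zero_of_isPiSystem hm hSpi hSgen hSu hi hω hA

/-! ### An integrable bound for the normalized orbit -/

section Domination

/-- The part of `r / √(k + 1)` above the level `1`. -/
noncomputable def excess (k : ℕ) (r : ℝ) : ℝ := if √(k + 1) < r then r / √(k + 1) else 0

lemma excess_nonneg (k : ℕ) (r : ℝ) : 0 ≤ excess k r := by
  unfold excess
  split_ifs with h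
  · exact div_nonneg ((Real.sqrt_nonneg _).trans h.le) (Real.sqrt_nonneg _)
  · exact le_rfl

lemma measurable_excess (k : ℕ) : Measurable (excess k) :=
  Measurable.ite (measurableSet_lt measurable_const measurable_id)
    (measurable_id.div_const _) measurable_const

lemma le_sqrt_mul_one_add_excess (k : ℕ) (r : ℝ) : r ≤ √(k + 1) * (1 + excess k r) := by
  have hpos : 0 < √((k : ℝ) + 1) := Real.sqrt_pos.2 (by positivity)
  unfold excess
  split_ifs with h
  · rw [mul_add, mul_div_cancel₀ _ hpos.ne']
    linarith
  · linarith

/-- Only indices with k + 1 < r² contribute, and the sum of 1/√(k + 1) over them is at most about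
2r. -/
lemma sum_excess_le {r : ℝ} (hr : 0 ≤ r) (n : ℕ) :
    ∑ k ∈ Finset.range n, excess k r ≤ 2 * r ^ 2 := by
  -- The minimum makes the induction work: the bound grows with √n while terms are nonzero and is
  -- needed no further after that.
  have key : ∑ k ∈ Finset.range n, excess k r ≤ r * (2 * min (√n) r) := by
    induction n with
    | zero => simp [hr]
    | succ n ih =>
      rw [Finset.sum_range_succ]
      have hle : √(n : ℝ) ≤ √((n : ℝ) + 1) := Real.sqrt_le_sqrt (by linarith)
      push_cast
      by_cases h : √((n : ℝ) + 1) < r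
      · have hpos : 0 < √((n : ℝ) + 1) := Real.sqrt_pos.2 (by positivity)
        have h1 : excess n r = r * (√((n : ℝ) + 1))⁻¹ := by
          rw [excess, if_pos h, div_eq_mul_inv]
        -- The comparison of 1/√ with the increments of 2√, which telescopes.
        have h2 : (√((n : ℝ) + 1))⁻¹ ≤ 2 * √((n : ℝ) + 1) - 2 * √(n : ℝ) := by
          rw [inv_le_iff_one_le_mul₀ hpos]
          have e1 := Real.sq_sqrt (show (0 : ℝ) ≤ n + 1 by positivity)
          have e2 := Real.sq_sqrt (show (0 : ℝ) ≤ n by positivity)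
          nlinarith [sq_nonneg (√((n : ℝ) + 1) - √(n : ℝ))]
        rw [min_eq_left h.le, h1]
        rw [min_eq_left (hle.trans h.le)] at ih
        nlinarith [mul_le_mul_of_nonneg_left h2 hr]
      · rw [excess, if_neg h, add_zero]
        refine ih.trans ?_
        gcongr
  refine key.trans ?_
  nlinarith [min_le_right (√(n : ℝ)) r, mul_le_mul_of_nonneg_left (min_le_right (√(n : ℝ)) r) hr]

variable {Ω : Type*} {mΩ : MeasurableSpace Ω} {P : Measure Ω} {T : Ω → Ω}

/-- An integrable bound for `‖D (T ^ (k + 1) x)‖ / √(k + 1) - 1`. -/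
noncomputable def orbitExcess (T : Ω → Ω) (D : Ω → ℂ) (x : Ω) : ENNReal :=
  ∑' k : ℕ, ENNReal.ofReal (excess k ‖D (T^[k + 1] x)‖)

lemma measurable_ofReal_excess_norm {D : Ω → ℂ} (hD : Measurable D) (k : ℕ) :
    Measurable fun x => ENNReal.ofReal (excess k ‖D x‖) :=
  ((measurable_excess k).comp hD.norm).ennreal_ofReal

lemma measurable_orbitExcess (hT : Measurable T) {D : Ω → ℂ} (hD : Measurable D) :
    Measurable (orbitExcess T D) :=
  Measurable.tsum fun k =>
    (measurable_ofReal_excess_norm hD k).comp (hT.iterate (k + 1))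

/-- Invariance removes the iterates of T term by term, and the remaining series is at most 2|D|²
pointwise. This is where the second moment is spent. -/
lemma lintegral_orbitExcess_ne_top (hT : MeasurePreserving T P P) {D : Ω → ℂ} (hD : Measurable D)
    (hD2 : MemLp D 2 P) : ∫⁻ x, orbitExcess T D x ∂P ≠ ⊤ := by
  have hm := measurable_ofReal_excess_norm hD
  have h1 : ∫⁻ x, orbitExcess T D x ∂P
      = ∫⁻ x, ∑' k : ℕ, ENNReal.ofReal (excess k ‖D x‖) ∂P := by
    simp only [orbitExcess]
    have hmT : ∀ k : ℕ, AEMeasurable (fun x => ENNReal.ofReal (excess k ‖D (T^[k + 1] x)‖)) P :=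
      fun k => ((hm k).comp (hT.measurable.iterate (k + 1))).aemeasurable
    rw [lintegral_tsum hmT, lintegral_tsum fun k => (hm k).aemeasurable]
    exact tsum_congr fun k => (hT.iterate (k + 1)).lintegral_comp (hm k)
  have h2 : ∀ x, ∑' k : ℕ, ENNReal.ofReal (excess k ‖D x‖) ≤ ENNReal.ofReal (2 * ‖D x‖ ^ 2) := by
    intro x
    rw [ENNReal.tsum_eq_iSup_nat]
    refine iSup_le fun n => ?_
    rw [← ENNReal.ofReal_sum_of_nonneg fun k _ => excess_nonneg k _]
    exact ENNReal.ofReal_le_ofReal (sum_excess_le (norm_nonneg _) n)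
  have hi : Integrable (fun x => 2 * ‖D x‖ ^ 2) P :=
    ((memLp_two_iff_integrable_sq_norm hD.aestronglyMeasurable).1 hD2).const_mul 2
  rw [h1]
  refine ((lintegral_mono h2).trans_lt ?_).ne
  rw [← ofReal_integral_eq_lintegral_ofReal hi (ae_of_all _ fun x => by positivity)]
  exact ENNReal.ofReal_lt_top

lemma norm_le_sqrt_mul_one_add_orbitExcess {D : Ω → ℂ} {x : Ω} (hx : orbitExcess T D x < ⊤)
    (k : ℕ) : ‖D (T^[k + 1] x)‖ ≤ √(k + 1) * (1 + (orbitExcess T D x).toReal) := by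
  refine (le_sqrt_mul_one_add_excess k _).trans ?_
  gcongr
  rw [← ENNReal.ofReal_le_iff_le_toReal hx.ne]
  exact ENNReal.le_tsum (f := fun k => ENNReal.ofReal (excess k ‖D (T^[k + 1] x)‖)) k

end Domination

/-! ### Martingale structure of the orbit, and the limit theorem along it -/

section RotatedOrbit

/-- The σ-algebra generated by `D ∘ T, …, D ∘ T ^ k`. -/
noncomputable abbrev orbitSigma {Ω : Type*} (T : Ω → Ω) (D : Ω → ℂ) (k : ℕ) : MeasurableSpace Ω :=
  MeasurableSpace.comap (fun x (j : Fin k) => D (T^[j + 1] x)) inferInstance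

/-- The reason for this filtration: the larger T^{-k}F₀ need not be countably generated, and then no
common null set would be at hand. -/
lemma countablyGenerated_orbitSigma {Ω : Type*} (T : Ω → Ω) (D : Ω → ℂ) (k : ℕ) :
    @MeasurableSpace.CountablyGenerated Ω (orbitSigma T D k) :=
  MeasurableSpace.CountablyGenerated.comap _

lemma measurable_orbitSigma {Ω : Type*} (T : Ω → Ω) (D : Ω → ℂ) {j k : ℕ} (hjk : j < k) :
    Measurable[orbitSigma T D k] fun x => D (T^[j + 1] x) :=
  (measurable_pi_apply (X := fun _ : Fin k => ℂ) ⟨j, hjk⟩).comp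
    (comap_measurable fun x (j : Fin k) => D (T^[j + 1] x))

lemma orbitSigma_le {Ω : Type*} {m : MeasurableSpace Ω} {T : Ω → Ω} {D : Ω → ℂ} {k : ℕ}
    (h : ∀ j < k, Measurable fun x => D (T^[j + 1] x)) : orbitSigma T D k ≤ m :=
  measurable_iff_comap_le.1 (measurable_pi_iff.2 fun j => h j j.2)

lemma monotone_orbitSigma {Ω : Type*} (T : Ω → Ω) (D : Ω → ℂ) : Monotone (orbitSigma T D) :=
  fun _ _ hkl => orbitSigma_le fun _ hj => measurable_orbitSigma T D (hj.trans_le hkl)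

lemma monotone_comap_iterate {Ω : Type*} {F₀ : MeasurableSpace Ω} {T : Ω → Ω}
    (h : F₀ ≤ F₀.comap T) : Monotone fun k => F₀.comap T^[k] := by
  refine monotone_nat_of_le_succ fun k => ?_
  rw [Function.iterate_succ', ← MeasurableSpace.comap_comp]
  exact MeasurableSpace.comap_mono h

variable {Ω : Type*} {F₀ mΩ : MeasurableSpace Ω} {P : Measure Ω} {T : Ω → Ω} {D : Ω → ℂ}

/-- `D ∘ T ^ (k + 1)` is orthogonal to the sets of `F₀` and of `σ(D ∘ T, …, D ∘ T ^ k)`. -/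
lemma setIntegral_iterate_eq_zero [IsFiniteMeasure P] (hT : MeasurePreserving T P P)
    (hF₀ : F₀ ≤ mΩ) (hF₀T : F₀ ≤ F₀.comap T) (hD : Measurable[F₀] D) (hDi : Integrable D P)
    (hDT : P[D ∘ T | F₀] =ᵐ[P] 0) (k : ℕ) (A C : Set Ω)
    (hA : MeasurableSet[orbitSigma T D k] A) (hC : MeasurableSet[F₀] C) :
    ∫ x in C ∩ A, D (T^[k + 1] x) ∂P = 0 := by
  have hmono := monotone_comap_iterate hF₀T
  have hA' : MeasurableSet[F₀.comap T^[k]] A := by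
    refine orbitSigma_le (m := F₀.comap T^[k]) (fun j hj => ?_) A hA
    have h1 : Measurable[F₀.comap T^[j + 1]] fun x => D (T^[j + 1] x) :=
      hD.comp (comap_measurable _)
    exact h1.mono (hmono hj) le_rfl
  have hC' : MeasurableSet[F₀.comap T^[k]] C := by
    have h0 : F₀.comap T^[0] ≤ F₀.comap T^[k] := hmono (Nat.zero_le k)
    rw [Function.iterate_zero, MeasurableSpace.comap_id] at h0
    exact h0 C hC
  -- Both sets lie in T^{-k}F₀, so the intersection is T^{-k}B with B in F₀, and invariance reduces
  -- the claim to ∫_B D ∘ T = 0.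
  obtain ⟨B, hB, hBeq⟩ := hC'.inter hA'
  have hDTi : Integrable (D ∘ T) P := hT.integrable_comp_of_integrable hDi
  have hDTm : Measurable (D ∘ T) := (hD.mono hF₀ le_rfl).comp hT.measurable
  have h1 := setIntegral_map (μ := P) (hF₀ B hB) (f := D ∘ T) (g := T^[k])
    hDTm.aestronglyMeasurable (hT.iterate k).measurable.aemeasurable
  rw [(hT.iterate k).map_eq, hBeq] at h1
  have h2 : ∫ x in B, (D ∘ T) x ∂P = 0 := by
    rw [← setIntegral_condExp hF₀ hDTi hB, setIntegral_congr_ae (g := 0) (hF₀ B hB)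
      (hDT.mono fun x hx _ => hx)]
    simp
  rw [h2] at h1
  rw [h1]
  simp only [Function.comp_apply, Function.iterate_succ_apply']

/-- Central limit theorem, for characteristic functions of rotated orbit sums under a measure
for which `D ∘ T ^ k` are martingale differences. -/
lemma tendsto_integral_exp_rotated {Q : Measure Ω} [IsProbabilityMeasure Q] (hT : Measurable T)
    (hD : Measurable D)
    (h0 : ∀ k, Integrable (fun x => D (T^[k + 1] x)) Q → ∀ A, MeasurableSet[orbitSigma T D k] A →
      ∫ x in A, D (T^[k + 1] x) ∂Q = 0)
    (hW : ∫⁻ x, orbitExcess T D x ∂Q < ⊤) {e : ℕ → ℂ} (he : ∀ k, ‖e k‖ = 1) {z c : ℂ}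
    (hez : ∀ k, e k ^ 2 = c * z ^ k) {V : ℝ}
    (hV : ∀ᵐ x ∂Q, Tendsto
      (fun n => rotatedAverage T 1 (fun y => ((‖D (T y)‖ ^ 2 : ℝ) : ℂ)) n x) atTop (nhds V))
    (hz : ∀ᵐ x ∂Q, Tendsto
      (fun n => rotatedAverage T z (fun y => D (T y) ^ 2) n x) atTop (nhds 0)) (w : ℂ) :
    Tendsto (fun n : ℕ => ∫ x, Complex.exp (Complex.I *
      (((√(n : ℝ))⁻¹ * ∑ k ∈ Finset.range n,
        (starRingEnd ℂ w * (e k * D (T^[k + 1] x))).re : ℝ) : ℂ)) ∂Q) atTop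
      (nhds (Complex.exp (-((‖w‖ ^ 2 * V / 2 : ℝ) : ℂ) / 2))) := by
  have hDm : ∀ k, Measurable fun x => D (T^[k + 1] x) := fun k => hD.comp (hT.iterate (k + 1))
  have hWm : Measurable (orbitExcess T D) := measurable_orbitExcess hT hD
  have hWtop : ∀ᵐ x ∂Q, orbitExcess T D x < ⊤ := ae_lt_top hWm hW.ne
  have hSi : Integrable (fun x => 1 + (orbitExcess T D x).toReal) Q :=
    (integrable_const _).add (integrable_toReal_of_lintegral_ne_top hWm.aemeasurable hW.ne)
  have hDi : ∀ k, Integrable (fun x => D (T^[k + 1] x)) Q := fun k => by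
    refine (hSi.const_mul √((k : ℝ) + 1)).mono' (hDm k).aestronglyMeasurable ?_
    filter_upwards [hWtop] with x hx using norm_le_sqrt_mul_one_add_orbitExcess hx k
  refine tendsto_integral_exp_martingale (ℱ := orbitSigma T D)
    (X := fun k x => (starRingEnd ℂ w * (e k * D (T^[k + 1] x))).re)
    (S := fun x => ‖w‖ * (1 + (orbitExcess T D x).toReal))
    (monotone_orbitSigma T D) (fun k => orbitSigma_le fun j _ => hDm j) (fun k => ?_)
    (fun k A hA => ?_) (hSi.const_mul _) ?_ ?_
  · exact Complex.measurable_re.comp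
      (((measurable_orbitSigma T D k.lt_succ_self).const_mul _).const_mul _)
  · have hi : IntegrableOn (fun x => starRingEnd ℂ w * (e k * D (T^[k + 1] x))) A Q :=
      (((hDi k).const_mul _).const_mul _).integrableOn
    have h1 := integral_re hi
    simp only [RCLike.re_eq_complex_re] at h1
    rw [h1, integral_const_mul, integral_const_mul, h0 k (hDi k) A hA]
    simp
  · filter_upwards [hWtop] with x hx k
    refine (Complex.abs_re_le_norm _).trans ?_
    rw [norm_mul, norm_mul, he, one_mul, RCLike.norm_conj]
    have := mul_le_mul_of_nonneg_left (norm_le_sqrt_mul_one_add_orbitExcess hx k) (norm_nonneg w)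
    linarith
  · filter_upwards [hV, hz] with x hx1 hx2
    -- This splits the squares into a modulus part, with a constant Cesàro limit, and an oscillating
    -- part, whose averages vanish.
    have hre : ∀ u : ℂ, u.re ^ 2 = (((‖u‖ ^ 2 : ℝ) : ℂ) / 2 + u ^ 2 / 2).re := fun u => by
      rw [← Complex.normSq_eq_norm_sq, Complex.normSq_apply, sq, sq]
      simp
      ring
    have hlim := (hx1.const_mul ((‖w‖ ^ 2 / 2 : ℝ) : ℂ)).add
      (hx2.const_mul ((starRingEnd ℂ w) ^ 2 * c / 2))
    have hlim' := (Complex.continuous_re.tendsto _).comp hlim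
    have hval : (((‖w‖ ^ 2 / 2 : ℝ) : ℂ) * (V : ℂ) + (starRingEnd ℂ w) ^ 2 * c / 2 * 0).re
        = ‖w‖ ^ 2 * V / 2 := by
      rw [mul_zero, add_zero, ← Complex.ofReal_mul, Complex.ofReal_re]
      ring
    rw [hval] at hlim'
    refine hlim'.congr fun n => ?_
    simp only [Function.comp_apply, rotatedAverage, one_pow, one_mul]
    rw [mul_smul_comm, mul_smul_comm, ← smul_add, Complex.smul_re, Finset.mul_sum, Finset.mul_sum,
      ← Finset.sum_add_distrib, Complex.re_sum]
    congr 1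
    refine Finset.sum_congr rfl fun k _ => ?_
    rw [hre]
    congr 1
    rw [norm_mul, norm_mul, he, one_mul, RCLike.norm_conj, ← Function.iterate_succ_apply' T k x,
      mul_pow _ (e k * _), mul_pow (e k), hez]
    push_cast
    ring

end RotatedOrbit

/-! ### Gaussian limit and Lévy's criterion -/

/-- The characteristic function of a complex variable whose real and imaginary parts are
independent centered Gaussians of variance `v`. -/
lemma charFun_map_complex_gaussian {Ω : Type*} {mΩ : MeasurableSpace Ω} {P : Measure Ω}
    [IsProbabilityMeasure P] {N₁ N₂ : Ω → ℝ} {v : NNReal} (hN : IndepFun N₁ N₂ P)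
    (hN₁ : HasLaw N₁ (gaussianReal 0 v) P) (hN₂ : HasLaw N₂ (gaussianReal 0 v) P) (w : ℂ) :
    charFun (P.map fun y => (N₁ y : ℂ) + N₂ y * Complex.I) w
      = Complex.exp (-((‖w‖ ^ 2 * v : ℝ) : ℂ) / 2) := by
  have hm₁ := hN₁.aemeasurable
  have hm₂ := hN₂.aemeasurable
  have hmap : ∀ {N : Ω → ℝ}, HasLaw N (gaussianReal 0 v) P → ∀ s : ℝ,
      ∫ y, Complex.exp (s * N y * Complex.I) ∂P = Complex.exp (-(v * s ^ 2 / 2)) := by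
    intro N hL s
    have h := charFun_gaussianReal (μ := 0) (v := v) s
    rw [charFun_apply_real, ← hL.map_eq, integral_map hL.aemeasurable (by fun_prop)] at h
    rw [h]
    simp
  rw [charFun_apply, integral_map (by fun_prop) (by fun_prop)]
  have hinner : ∀ y, Complex.exp ((inner ℝ ((N₁ y : ℂ) + N₂ y * Complex.I) w : ℝ) * Complex.I)
      = Complex.exp (w.re * N₁ y * Complex.I) * Complex.exp (w.im * N₂ y * Complex.I) := by
    intro y
    rw [← Complex.exp_add, Complex.inner]
    congr 1
    have : (w * (starRingEnd ℂ) ((N₁ y : ℂ) + N₂ y * Complex.I)).re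
        = w.re * N₁ y + w.im * N₂ y := by
      simp [Complex.mul_re]
    rw [this]
    push_cast
    ring
  simp only [hinner]
  have hind := hN.integral_fun_comp_mul_comp (f := fun r : ℝ => Complex.exp (w.re * r * Complex.I))
    (g := fun r : ℝ => Complex.exp (w.im * r * Complex.I)) hm₁ hm₂ (by fun_prop) (by fun_prop)
  rw [hind, hmap hN₁, hmap hN₂, ← Complex.exp_add, ← Complex.normSq_eq_norm_sq,
    Complex.normSq_apply]
  congr 1
  push_cast
  ring

/-- Lévy's criterion for convergence in distribution of complex random variables. -/
lemma tendstoInDistribution_of_tendsto_charFun {Ω Ω' : Type*} {mΩ : MeasurableSpace Ω}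
    {mΩ' : MeasurableSpace Ω'} {Q : Measure Ω} [IsProbabilityMeasure Q] {P' : Measure Ω'}
    [IsProbabilityMeasure P'] {Z : ℕ → Ω → ℂ} {N : Ω' → ℂ} (hZ : ∀ n, AEMeasurable (Z n) Q)
    (hN : AEMeasurable N P')
    (h : ∀ w, Tendsto (fun n => charFun (Q.map (Z n)) w) atTop (nhds (charFun (P'.map N) w))) :
    TendstoInDistribution Z atTop N (fun _ => Q) P' where
  forall_aemeasurable := hZ
  aemeasurable_limit := hN
  tendsto := ProbabilityMeasure.tendsto_of_tendsto_charFun h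

/-! ### Proof of the quenched limit theorem -/

theorem mainTheorem11 {Ω : Type*} {F₀ mΩ : MeasurableSpace Ω}
    (P : Measure Ω) [IsProbabilityMeasure P]
    -- the bi-measurable ergodic measure-preserving bijection and the σ-algebra `F₀ ⊆ T⁻¹ F₀`
    (T : Ω ≃ᵐ Ω) (hT : Ergodic T P)
    (hF₀ : F₀ ≤ mΩ) (hF₀T : F₀ ≤ F₀.comap T)
    -- the regular conditional probability `ω ↦ P^ω` given `F₀`
    (κ : @Kernel Ω Ω F₀ mΩ) [∀ ω, IsProbabilityMeasure (κ ω)] (hκ : IsRegularCondProb P κ)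
    (t : ℝ) (ht : t ∈ Set.Ioo 0 (2 * Real.pi))
    (ht_eig : ¬ IsKoopmanEigenvalue hT.toMeasurePreserving
      (Complex.exp (-2 * Complex.I * t)))
    (D : Ω → ℂ) (hD : Measurable[F₀] D) (hD2 : MemLp D 2 P)
    (hDT : P[D ∘ T | F₀] =ᵐ[P] 0)
    -- independent centered normal variables `N₁`, `N₂` with variance `E|D|² / 2`
    {Ω' : Type*} {mΩ' : MeasurableSpace Ω'} (P' : Measure Ω') [IsProbabilityMeasure P']
    (N₁ N₂ : Ω' → ℝ) (hN : IndepFun N₁ N₂ P')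
    (hN₁ : HasLaw N₁ (gaussianReal 0 (Real.toNNReal ((∫ ω, ‖D ω‖ ^ 2 ∂P) / 2))) P')
    (hN₂ : HasLaw N₂ (gaussianReal 0 (Real.toNNReal ((∫ ω, ‖D ω‖ ^ 2 ∂P) / 2))) P') :
    ∀ᵐ ω ∂P, TendstoInDistribution
      (fun (n : ℕ) (x : Ω) => (1 / Real.sqrt n) • rotatedMart T D t n x) atTop
      (fun y => (N₁ y, N₂ y)) (fun _ => κ ω) P' := by
  have hTP := hT.toMeasurePreserving
  have hDm : Measurable D := hD.mono hF₀ le_rfl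
  have hDi : Integrable D P := hD2.integrable (by norm_num)
  have hD2i : Integrable (fun x => ‖D x‖ ^ 2) P :=
    (memLp_two_iff_integrable_sq_norm hDm.aestronglyMeasurable).1 hD2
  set V : ℝ := ∫ x, ‖D x‖ ^ 2 ∂P with hVdef
  have hV0 : 0 ≤ V := integral_nonneg fun x => by positivity
  set z : ℂ := Complex.exp (2 * Complex.I * t) with hzdef
  have hexpn : ∀ r : ℝ, ‖Complex.exp (Complex.I * r)‖ = 1 := fun r => by
    rw [mul_comm]
    exact Complex.norm_exp_ofReal_mul_I r
  have hzn : ‖z‖ = 1 := by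
    have := hexpn (2 * t)
    rw [hzdef, ← this]
    congr 2
    push_cast
    ring
  have hzinv : z⁻¹ = Complex.exp (-2 * Complex.I * t) := by
    rw [hzdef, ← Complex.exp_neg]
    congr 1
    ring
  have hVint : ∫ x, ((‖D (T x)‖ ^ 2 : ℝ) : ℂ) ∂P = V := by
    rw [integral_complex_ofReal, hVdef]
    congr 1
    exact hTP.integral_comp T.measurableEmbedding (fun x => ‖D x‖ ^ 2)
  have hconv1 := Ergodic.ae_tendsto_average hT (f := fun y => ((‖D (T y)‖ ^ 2 : ℝ) : ℂ))
    (Complex.measurable_ofReal.comp ((hDm.comp T.measurable).norm.pow_const 2))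
    (hTP.integrable_comp_of_integrable hD2i).ofReal
  rw [hVint] at hconv1
  -- The argument is D ∘ T because the martingale sums start at k = 1, whereas the averages start at
  -- 0.
  have hconv2 := ae_tendsto_rotatedAverage_zero hTP hzn (by rwa [hzinv])
    (f := fun y => D (T y) ^ 2) ((hDm.comp T.measurable).pow_const 2) (by
      have h1 : Integrable (fun x => D x ^ 2) P :=
        hD2i.mono' (hDm.pow_const 2).aestronglyMeasurable (ae_of_all _ fun x => by simp)
      exact hTP.integrable_comp_of_integrable h1)
  have horth : ∀ᵐ ω ∂P, ∀ k, Integrable (fun x => D (T^[k + 1] x)) (κ ω) →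
      ∀ A, MeasurableSet[orbitSigma T D k] A → ∫ x in A, D (T^[k + 1] x) ∂(κ ω) = 0 := by
    refine ae_all_iff.2 fun k => ?_
    exact hκ.ae_forall_setIntegral_eq_zero hF₀
      (orbitSigma_le fun j _ => hDm.comp (T.measurable.iterate (j + 1)))
      (countablyGenerated_orbitSigma T D k) (hDm.comp (T.measurable.iterate (k + 1)))
      ((hTP.iterate (k + 1)).integrable_comp_of_integrable hDi)
      (setIntegral_iterate_eq_zero hTP hF₀ hF₀T hD hDi hDT k)
  -- None of these conditions involves the frequency `w`, so one set of full measure serves all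
  -- characteristic-function arguments.
  filter_upwards [horth, hκ.ae_ae hF₀ hconv1, hκ.ae_ae hF₀ hconv2,
    hκ.ae_lintegral_lt_top hF₀ (measurable_orbitExcess T.measurable hDm)
      (lintegral_orbitExcess_ne_top hTP hDm hD2)] with ω h0 h1 h2 hW
  set e : ℕ → ℂ := fun k => Complex.exp (Complex.I * ((k + 1 : ℕ) : ℂ) * t) with he
  have hen : ∀ k, ‖e k‖ = 1 := fun k => by
    rw [← hexpn (((k + 1 : ℕ) : ℝ) * t)]
    simp only [he]
    congr 2
    push_cast
    ring
  -- The extra factor z comes from the index shift by one; it is constant in k and does not affect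
  -- the zero limit.
  have hez : ∀ k, e k ^ 2 = z * z ^ k := fun k => by
    simp only [he, hzdef]
    rw [← pow_succ', ← Complex.exp_nat_mul, ← Complex.exp_nat_mul]
    congr 1
    push_cast
    ring
  -- The pair is encoded as a complex number, where the real inner product is Re(conj(w) u), and
  -- decoded at the end by a continuous map.
  set Z : ℕ → Ω → ℂ := fun n x =>
    (((√(n : ℝ))⁻¹ : ℝ) : ℂ) * ∑ k ∈ Finset.range n, e k * D (T^[k + 1] x) with hZ
  have hZm : ∀ n, Measurable (Z n) := fun n => Measurable.const_mul
    (Finset.measurable_sum _ fun k _ => (hDm.comp (T.measurable.iterate (k + 1))).const_mul _) _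
  have hm₁ := hN₁.aemeasurable
  have hm₂ := hN₂.aemeasurable
  have hmain : TendstoInDistribution Z atTop (fun y => (N₁ y : ℂ) + N₂ y * Complex.I)
      (fun _ => κ ω) P' := by
    refine tendstoInDistribution_of_tendsto_charFun (fun n => (hZm n).aemeasurable)
      (by fun_prop) fun w => ?_
    rw [charFun_map_complex_gaussian hN hN₁ hN₂, Real.coe_toNNReal _ (by positivity),
      ← mul_div_assoc]
    refine (tendsto_integral_exp_rotated T.measurable hDm h0 hW hen hez h1 h2 w).congr fun n => ?_
    rw [charFun_apply, integral_map (hZm n).aemeasurable (by fun_prop)]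
    refine integral_congr_ae (ae_of_all _ fun x => ?_)
    simp only
    rw [mul_comm, real_inner_comm, Complex.inner, ← Complex.re_sum, ← Finset.mul_sum, hZ]
    simp only
    rw [mul_assoc, Complex.re_ofReal_mul, mul_comm (starRingEnd ℂ w)]
  have hfinal := hmain.continuous_comp (g := fun u : ℂ => (u.re, u.im)) (by fun_prop)
  have hlim_eq : (fun u : ℂ => (u.re, u.im)) ∘ (fun y => (N₁ y : ℂ) + N₂ y * Complex.I)
      = fun y => (N₁ y, N₂ y) := by
    funext y
    simp
  have hseq_eq : (fun n => (fun u : ℂ => (u.re, u.im)) ∘ Z n)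
      = fun (n : ℕ) (x : Ω) => (1 / Real.sqrt n) • rotatedMart T D t n x := by
    funext n x
    have hsum : rotatedMart T D t n x = ((∑ k ∈ Finset.range n, e k * D (T^[k + 1] x)).re,
        (∑ k ∈ Finset.range n, e k * D (T^[k + 1] x)).im) := by
      rw [rotatedMart, Finset.range_eq_Ico, Complex.re_sum, Complex.im_sum,
        show Finset.Icc 1 n = Finset.Ico (0 + 1) (n + 1) from rfl, ← Finset.sum_Ico_add']
      exact Prod.ext (Prod.fst_sum ..) (Prod.snd_sum ..)
    rw [hsum, one_div, Prod.smul_mk, Function.comp_apply, hZ]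
    simp only [Complex.re_ofReal_mul, Complex.im_ofReal_mul, smul_eq_mul]
  rwa [hlim_eq, hseq_eq] at hfinal
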